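/- **Setting.** Let $d\in\{2,3\}$, let $\Omega\subset\mathbb R^d$ be a bounded open set, and let $\alpha>0$. $H^1_0(\Omega)$ is the closure of the complex-valued functions in $C_c^\infty(\Omega)$ in the norm $(\|u\|_{L^2}^2+\|\nabla u\|_{L^2}^2)^{1/2}$. On $[H^1_0(\Omega)]^2$ we use the real inner products $$(\mathbf u,\mathbf v)_{L^2}=\sum_{i=1,2}\mathrm{Re}\int_\Omega u_i\overline{v_i}\,dx,\qquad (\mathbf u,\mathbf v)_{H^1_0}=\sum_{i=1,2}\mathrm{Re}\int_\Omega \nabla u_i\cdot\nabla\overline{v_i}\,dx,$$ with the corresponding norms $\|\cdot\|_{L^2}$ and $\|\cdot\|_{H^1_0}$. The data are real functions $V_1,V_2$ on $\Omega$, a real matrix $K=(k_{ij})_{i,j=1,2}$, real numbers $\omega_1,\omega_2$ (rotation frequencies) and a real number $\beta$ (Josephson coupling). Put $k_m=\max_{i,j}|k_{ij}|$, $L_zu=-\mathrm i(x\,\partial_yu-y\,\partial_xu)$, where $x,y$ are the first two coordinates, and $\rho_i(\Psi)=k_{i1}|\psi_1|^2+k_{i2}|\psi_2|^2$. The energy of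 $\Psi=(\psi_1,\psi_2)\in[H^1_0(\Omega)]^2$ is $$E(\Psi)=\sum_{i=1,2}\int_\Omega\Big(\tfrac12|\nabla\psi_i|^2+V_i|\psi_i|^2+\tfrac12\rho_i(\Psi)|\psi_i|^2-\omega_i\,\mathrm{Re}(\overline{\psi_i}L_z\psi_i)\Big)dx+2\beta\int_\Omega\mathrm{Re}(\psi_1\overline{\psi_2})\,dx,$$ and $\mathcal M$ is the set of $\Psi\in[H^1_0(\Omega)]^2$ with $\|\Psi\|_{L^2}=1$ and finite energy (integrable energy density). For $\Psi,\mathbf u,\mathbf v\in[H^1_0(\Omega)]^2$ put $$\langle\mathcal H_\Psi\mathbf u,\mathbf v\rangle=\sum_{i=1,2}\mathrm{Re}\int_\Omega\Big(\tfrac12\nabla u_i\cdot\nabla\overline{v_i}+V_iu_i\overline{v_i}+\rho_i(\Psi)u_i\overline{v_i}-\omega_i\overline{v_i}L_zu_i\Big)dx+\beta\,\mathrm{Re}\int_\Omega (u_1\overline{v_2}+u_2\overline{v_1})\,dx .$$ For $\tau>0$ and $\Psi^0\in\mathcal M$, the GFSI scheme is $$\widetilde\Psi^{n+1}=(I+\tau\mathcal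 H_{\Psi^n})^{-1}\Psi^n,\qquad \Psi^{n+1}=\widetilde\Psi^{n+1}/\|\widetilde\Psi^{n+1}\|_{L^2},\qquad n\ge0,$$ where $\widetilde\Psi^{n+1}\in[H^1_0(\Omega)]^2$ is the weak solution: $(\widetilde\Psi^{n+1},\mathbf v)_{L^2}+\tau\langle\mathcal H_{\Psi^n}\widetilde\Psi^{n+1},\mathbf v\rangle=(\Psi^n,\mathbf v)_{L^2}$ for all $\mathbf v\in[H^1_0(\Omega)]^2$. **Assumptions.** * **A1.** For $i=1,2$: $V_i\in L^\infty(\Omega)$ and $V_i\ge\frac{1+\alpha}2\omega_i^2(x^2+y^2)+|\beta|$ almost everywhere in $\Omega$. * **A2.** $K$ is symmetric, and it is positive definite or all its entries are non-negative. **Theorem (energy dissipation).** Let $C_0=\frac{\alpha}{2(1+\alpha)}$. For given $d$, $\Omega$ and $\alpha$ there is a function $\tau_0:\mathbb R\times\mathbb R\to(0,\infty)$ such that the following holds for all data $V_1,V_2,K,\omega_1,\omega_2,\beta$ satisfying **A1** and **A2**, all $\Psi_0\in\mathcal M$ and all $\tau$ with $0<\tau<\tau_0(E(\Psi_0),k_m)$.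 The GFSI scheme with $\Psi^0=\Psi_0$ is well defined: there is exactly one sequence $(\Psi^n)_{n\ge0}$ that it generates, with $\widetilde\Psi^{n+1}\neq0$ for all $n\ge0$; for every $n\ge0$ the weak equation $(I+\tau\mathcal H_{\Psi^n})\mathbf u=\mathbf w$ has exactly one solution $\mathbf u\in[H^1_0(\Omega)]^2$ for every $\mathbf w$ in the (real) dual space of $[H^1_0(\Omega)]^2$; and $\Psi^n\in\mathcal M$. Moreover $$E(\Psi^{n+1})-E(\Psi^n)\le-\frac{C_0}2\,\|\Psi^{n+1}-\Psi^n\|_{H^1_0}^2\qquad\text{for all }n\ge0 .$$ -/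

import Mathlib

open MeasureTheory TopologicalSpace
open scoped Distributions ComplexConjugate

noncomputable section

namespace GrossPitaevskii

/-- Euclidean space `ℝ^d`. -/
abbrev Space (d : ℕ) : Type := EuclideanSpace ℝ (Fin d)

/-- The complex Lebesgue space `L²(Ω)`. -/
abbrev L2 {d : ℕ} (Ω : Opens (Space d)) : Type :=
  Lp ℂ 2 (volume.restrict (Ω : Set (Space d)))

/-- The space `L²(Ω) × L²(Ω)^d` of pairs (function, vector field) with its Hilbert norm. -/
abbrev Jet {d : ℕ} (Ω : Opens (Space d)) : Type :=
  WithLp 2 (L2 Ω × PiLp 2 (fun _ : Fin d => L2 Ω))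

/-- The pairs `(φ, ∇φ)` with `φ` a complex-valued smooth function with compact support in `Ω`. -/
def testJets {d : ℕ} (Ω : Opens (Space d)) : Submodule ℝ (Jet Ω) where
  carrier := {w | ∃ φ : 𝓓(Ω, ℂ),
    (w.fst : Space d → ℂ) =ᵐ[volume.restrict (Ω : Set (Space d))] φ ∧
    ∀ j : Fin d, (w.snd j : Space d → ℂ) =ᵐ[volume.restrict (Ω : Set (Space d))]
      fun x => fderiv ℝ φ x (EuclideanSpace.single j 1)}
  zero_mem' := by
    refine ⟨0, ?_, fun j => ?_⟩
    · exact (Lp.coeFn_zero ℂ 2 _).trans (by rw [FunLike.coe_zero])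
    · refine (Lp.coeFn_zero ℂ 2 _).trans ?_
      rw [FunLike.coe_zero]
      filter_upwards with x
      simp
  add_mem' := by
    rintro a b ⟨φ, h1, h2⟩ ⟨χ, h3, h4⟩
    refine ⟨φ + χ, ?_, fun j => ?_⟩
    · refine (Lp.coeFn_add a.fst b.fst).trans ?_
      filter_upwards [h1, h3] with x hx hy
      simp [hx, hy]
    · refine (Lp.coeFn_add (a.snd j) (b.snd j)).trans ?_
      filter_upwards [h2 j, h4 j] with x hx hy
      have e1 : DifferentiableAt ℝ φ x := (φ.contDiff.differentiable (by simp)) x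
      have e2 : DifferentiableAt ℝ χ x := (χ.contDiff.differentiable (by simp)) x
      rw [FunLike.coe_add, fderiv_add e1 e2]
      simp [hx, hy]
  smul_mem' := by
    rintro c a ⟨φ, h1, h2⟩
    refine ⟨c • φ, ?_, fun j => ?_⟩
    · refine (Lp.coeFn_smul c a.fst).trans ?_
      filter_upwards [h1] with x hx
      simp [hx]
    · refine (Lp.coeFn_smul c (a.snd j)).trans ?_
      filter_upwards [h2 j] with x hx
      have e1 : DifferentiableAt ℝ φ x := (φ.contDiff.differentiable (by simp)) x
      rw [FunLike.coe_smul, fderiv_const_smul e1]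
      simp [hx]

/-- The Sobolev space `H¹₀(Ω)` of complex-valued functions, the closure of `C_c^∞(Ω)` in the norm
`(‖u‖² + ‖∇u‖²)^{1/2}`. An element is stored as the pair `(u, ∇u)` of the function and its weak
gradient; the limit of the gradients of test functions is determined by the limit `u`. -/
def H10 {d : ℕ} (Ω : Opens (Space d)) : Submodule ℝ (Jet Ω) :=
  (testJets Ω).topologicalClosure

/-- The underlying function of an element of `H¹₀(Ω)`. -/
def fn {d : ℕ} {Ω : Opens (Space d)} (u : H10 Ω) : Space d → ℂ := (u : Jet Ω).fst

/-- The weak partial derivative `∂_j u` of an element of `H¹₀(Ω)`. -/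
def pd {d : ℕ} {Ω : Opens (Space d)} (u : H10 Ω) (j : Fin d) : Space d → ℂ :=
  (u : Jet Ω).snd j

/-- `[H¹₀(Ω)]²`: two-component wave functions. -/
abbrev Wave {d : ℕ} (Ω : Opens (Space d)) : Type := PiLp 2 (fun _ : Fin 2 => H10 Ω)

/-- `(u, v)_{L²} = Re ∫_Ω u v̄`. -/
def innerL2 {d : ℕ} {Ω : Opens (Space d)} (u v : H10 Ω) : ℝ :=
  (∫ x in (Ω : Set (Space d)), fn u x * conj (fn v x)).re

/-- `(u, v)_{H¹₀} = Re ∫_Ω ∇u · ∇v̄`. -/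
def innerH10 {d : ℕ} {Ω : Opens (Space d)} (u v : H10 Ω) : ℝ :=
  (∫ x in (Ω : Set (Space d)), ∑ j, pd u j x * conj (pd v j x)).re

/-- The `L²` inner product on `[H¹₀(Ω)]²`. -/
def waveInnerL2 {d : ℕ} {Ω : Opens (Space d)} (u v : Wave Ω) : ℝ :=
  ∑ i, innerL2 (u i) (v i)

/-- The `H¹₀` inner product on `[H¹₀(Ω)]²`. -/
def waveInnerH10 {d : ℕ} {Ω : Opens (Space d)} (u v : Wave Ω) : ℝ :=
  ∑ i, innerH10 (u i) (v i)

/-- The `L²` norm on `[H¹₀(Ω)]²`. -/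
def normL2 {d : ℕ} {Ω : Opens (Space d)} (u : Wave Ω) : ℝ := √(waveInnerL2 u u)

/-- The norm of `[H¹₀(Ω)]²`, that is, the `L²` norm of the gradient. -/
def normH10 {d : ℕ} {Ω : Opens (Space d)} (u : Wave Ω) : ℝ := √(waveInnerH10 u u)

/-- The data of the model: the real potentials `V_i`, the interaction matrix `K = (k_ij)`,
the rotation frequencies `ω_i` and the strength `β` of the Josephson junction. -/
structure Data (d : ℕ) where
  V : Fin 2 → Space d → ℝ
  K : Matrix (Fin 2) (Fin 2) ℝ
  ω : Fin 2 → ℝ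
  β : ℝ

/-- The assumption on the potentials: `V_i ∈ L^∞(Ω)` and
`V_i ≥ (1 + α)/2 · ω_i² (x² + y²) + |β|` almost everywhere in `Ω`. -/
def A1 {d : ℕ} [NeZero d] (Ω : Opens (Space d)) (α : ℝ) (P : Data d) : Prop :=
  ∀ i, MemLp (P.V i) ⊤ (volume.restrict (Ω : Set (Space d))) ∧
    ∀ᵐ x ∂(volume.restrict (Ω : Set (Space d))),
      (1 + α) / 2 * P.ω i ^ 2 * (x 0 ^ 2 + x 1 ^ 2) + |P.β| ≤ P.V i x

/-- The assumption on the interaction matrix: `K` is symmetric, and it is positive definite or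
all its entries are non-negative. -/
def A2 {d : ℕ} (P : Data d) : Prop :=
  P.K.IsSymm ∧ (P.K.PosDef ∨ ∀ i j, 0 ≤ P.K i j)

/-- `k_m = max |k_ij|`. -/
def Data.km {d : ℕ} (P : Data d) : ℝ :=
  max (max |P.K 0 0| |P.K 0 1|) (max |P.K 1 0| |P.K 1 1|)

/-- `L_z u = -i (x ∂_y u - y ∂_x u)`. -/
def Lz {d : ℕ} [NeZero d] {Ω : Opens (Space d)} (u : H10 Ω) (x : Space d) : ℂ :=
  -Complex.I * ((x 0 : ℂ) * pd u 1 x - (x 1 : ℂ) * pd u 0 x)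

/-- `ρ_i(Ψ) = k_{i1} |ψ₁|² + k_{i2} |ψ₂|²`. -/
def rho {d : ℕ} {Ω : Opens (Space d)} (P : Data d) (Ψ : Wave Ω) (i : Fin 2) (x : Space d) : ℝ :=
  ∑ j, P.K i j * ‖fn (Ψ j) x‖ ^ 2

/-- The energy density; the rotation term enters through its real part (the integral of its
imaginary part vanishes on `H¹₀(Ω)`). -/
def energyDensity {d : ℕ} [NeZero d] {Ω : Opens (Space d)} (P : Data d) (Ψ : Wave Ω)
    (x : Space d) : ℝ :=
  (∑ i, ((1 / 2) * (∑ j, ‖pd (Ψ i) j x‖ ^ 2) + P.V i x * ‖fn (Ψ i) x‖ ^ 2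
      + (1 / 2) * rho P Ψ i x * ‖fn (Ψ i) x‖ ^ 2
      - P.ω i * (conj (fn (Ψ i) x) * Lz (Ψ i) x).re))
    + 2 * P.β * (fn (Ψ 0) x * conj (fn (Ψ 1) x)).re

/-- The Gross-Pitaevskii energy `E(Ψ)`. -/
def energy {d : ℕ} [NeZero d] {Ω : Opens (Space d)} (P : Data d) (Ψ : Wave Ω) : ℝ :=
  ∫ x in (Ω : Set (Space d)), energyDensity P Ψ x

/-- The set `𝓜` of normalized wave functions of finite energy. -/
def admissible {d : ℕ} [NeZero d] (Ω : Opens (Space d)) (P : Data d) : Set (Wave Ω) :=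
  {Ψ | normL2 Ψ = 1 ∧
    IntegrableOn (energyDensity P Ψ) (Ω : Set (Space d)) volume}

/-- The pairing `⟨H_{ψ_i} u, v⟩` of the `i`-th diagonal entry of the Hamiltonian. -/
def hamiltonianDiag {d : ℕ} [NeZero d] {Ω : Opens (Space d)} (P : Data d) (Ψ : Wave Ω)
    (i : Fin 2) (u v : H10 Ω) : ℝ :=
  (∫ x in (Ω : Set (Space d)),
    ((1 / 2) * (∑ j, pd u j x * conj (pd v j x)) + (P.V i x : ℂ) * fn u x * conj (fn v x)
      + (rho P Ψ i x : ℂ) * fn u x * conj (fn v x)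
      - (P.ω i : ℂ) * conj (fn v x) * Lz u x)).re

/-- The pairing `⟨H_Ψ u, v⟩`. -/
def hamiltonian {d : ℕ} [NeZero d] {Ω : Opens (Space d)} (P : Data d) (Ψ u v : Wave Ω) : ℝ :=
  (∑ i, hamiltonianDiag P Ψ i (u i) (v i))
    + P.β * innerL2 (u 0) (v 1) + P.β * innerL2 (u 1) (v 0)

/-- The pairing `⟨(I + τ H_Ψ) u, v⟩`. -/
def implicitForm {d : ℕ} [NeZero d] {Ω : Opens (Space d)} (P : Data d) (τ : ℝ)
    (Ψ u v : Wave Ω) : ℝ :=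
  waveInnerL2 u v + τ * hamiltonian P Ψ u v

/-- `(I + τ H_Ψ)⁻¹` is defined on the dual space of `[H¹₀(Ω)]²`: for every continuous real-linear
functional `w` the weak equation `(I + τ H_Ψ) u = w` has exactly one solution `u`. -/
def ImplicitSolvable {d : ℕ} [NeZero d] {Ω : Opens (Space d)} (P : Data d) (τ : ℝ)
    (Ψ : Wave Ω) : Prop :=
  ∀ w : Wave Ω →L[ℝ] ℝ, ∃! u : Wave Ω, ∀ v : Wave Ω, implicitForm P τ Ψ u v = w v

/-- One step of the scheme: `Φ = Ψt / ‖Ψt‖` where `Ψt ≠ 0` is a weak solution in `[H¹₀(Ω)]²` of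
`(I + τ H_Ψ) Ψt = Ψ`. -/
def IsGFSIStep {d : ℕ} [NeZero d] {Ω : Opens (Space d)} (P : Data d) (τ : ℝ)
    (Ψ Φ : Wave Ω) : Prop :=
  ∃ Ψt : Wave Ω, (∀ v : Wave Ω, implicitForm P τ Ψ Ψt v = waveInnerL2 Ψ v) ∧
    normL2 Ψt ≠ 0 ∧ Φ = (normL2 Ψt)⁻¹ • Ψt

/-- `Ψ` is a sequence generated by the scheme with time step `τ` and initial value `Ψ0`. -/
def IsGFSISequence {d : ℕ} [NeZero d] {Ω : Opens (Space d)} (P : Data d) (τ : ℝ)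
    (Ψ0 : Wave Ω) (Ψ : ℕ → Wave Ω) : Prop :=
  Ψ 0 = Ψ0 ∧ ∀ n, IsGFSIStep P τ (Ψ n) (Ψ (n + 1))

/-- `C₀ = α / (2 (1 + α))`. -/
def C0 (α : ℝ) : ℝ := α / (2 * (1 + α))

end GrossPitaevskii

end

/-!
Dissipation of the energy along the scheme rests on an exact identity and on one inequality.

Write `H` for the Hamiltonian frozen at the current state `Ψ`, let `Φ` be the next state,
`δ = Φ - Ψ`, and let `s` be the `L²` norm of the solution of the implicit equation. Since `H` is
symmetric (`hamiltonian_comm`; for the rotation term this is integration by parts for test functions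
and density, `re_integral_Lz_comm`) and both states have norm one, the weak equation gives
`⟨HΦ, Φ⟩ - ⟨HΨ, Ψ⟩ = -(1 + 1/s)/τ ‖δ‖² - ⟨Hδ, δ⟩` (`quadratic_sub_le_of_implicit_step`). The energy
differs from this by half of the integral of the form `K` in the density differences
`|φ_i|² - |ψ_i|²` (`energyDensity_sub_eq`, `energy_sub_le`).

The quadratic part of the energy is bounded below by `C₀ ‖∇u‖²` (`quadDensity_ge`): the potential
absorbs the rotation term, at the cost of part of the kinetic energy, and the Josephson term. What
is left are quartic integrals, and by Hölder's inequality and the embedding of `H¹₀(Ω)` into `L⁶(Ω)` in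
dimensions two and three, `∫ |w|² |u|² ≤ C³ ‖∇w‖² ‖∇u‖ ‖u‖` (`integral_quartic_le`). As only one
power of `‖∇u‖` appears, Young's inequality splits the right side into a small multiple of `‖∇u‖²`
and a multiple of `‖u‖²`.

For the frozen Hamiltonian this says that it is coercive up to a multiple of the `L²` norm, so that
the implicit equation is solvable by the Lax-Milgram theorem when `τ` is small
(`implicitSolvable_of_coercive`), although `ρ_i(Ψ)` may be negative. For the energy, it says that
`‖δ‖²/τ` and `C₀ ‖∇δ‖²` together dominate the errors, given bounds on `∇Ψ` and `∇Φ`. The former is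
bounded by `E(Ψ)`, because the interaction energy is nonnegative (`energy_ge`); the latter because
`⟨HΦ, Φ⟩ ≤ ⟨HΨ, Ψ⟩ ≤ 2 E(Ψ)` by the identity above (`energy_step_le`). As the energy decreases, one
threshold for `τ`, given by the initial energy, serves all steps.
-/

noncomputable section

namespace GrossPitaevskii

variable {d : ℕ} {Ω : Opens (Space d)}

/-! ### Elements of `H¹₀(Ω)` as functions -/

theorem fn_memLp (u : H10 Ω) : MemLp (fn u) 2 (volume.restrict (Ω : Set (Space d))) :=
  Lp.memLp _

theorem pd_memLp (u : H10 Ω) (j : Fin d) :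
    MemLp (pd u j) 2 (volume.restrict (Ω : Set (Space d))) :=
  Lp.memLp _

theorem fn_add (u v : H10 Ω) :
    fn (u + v) =ᵐ[volume.restrict (Ω : Set (Space d))] fn u + fn v :=
  Lp.coeFn_add (u : Jet Ω).fst (v : Jet Ω).fst

theorem fn_sub (u v : H10 Ω) :
    fn (u - v) =ᵐ[volume.restrict (Ω : Set (Space d))] fn u - fn v :=
  Lp.coeFn_sub (u : Jet Ω).fst (v : Jet Ω).fst

theorem fn_smul (c : ℝ) (u : H10 Ω) :
    fn (c • u) =ᵐ[volume.restrict (Ω : Set (Space d))] c • fn u :=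
  Lp.coeFn_smul c (u : Jet Ω).fst

theorem pd_add (u v : H10 Ω) (j : Fin d) :
    pd (u + v) j =ᵐ[volume.restrict (Ω : Set (Space d))] pd u j + pd v j :=
  Lp.coeFn_add ((u : Jet Ω).snd j) ((v : Jet Ω).snd j)

theorem pd_smul (c : ℝ) (u : H10 Ω) (j : Fin d) :
    pd (c • u) j =ᵐ[volume.restrict (Ω : Set (Space d))] c • pd u j :=
  Lp.coeFn_smul c ((u : Jet Ω).snd j)

theorem Lz_add [NeZero d] (u v : H10 Ω) :
    Lz (u + v) =ᵐ[volume.restrict (Ω : Set (Space d))] Lz u + Lz v := by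
  filter_upwards [pd_add u v 0, pd_add u v 1] with x h0 h1
  simp only [Lz, h0, h1, Pi.add_apply]
  ring

theorem Lz_smul [NeZero d] (c : ℝ) (u : H10 Ω) :
    Lz (c • u) =ᵐ[volume.restrict (Ω : Set (Space d))] c • Lz u := by
  filter_upwards [pd_smul c u 0, pd_smul c u 1] with x h0 h1
  simp only [Lz, h0, h1, Pi.smul_apply, Complex.real_smul]
  ring

/-! ### The two inner products as Hilbert space inner products -/

theorem integrable_mul_conj {X : Type*} [MeasurableSpace X] {μ : Measure X} {f g : X → ℂ}
    (hf : MemLp f 2 μ) (hg : MemLp g 2 μ) : Integrable (fun x => f x * conj (g x)) μ :=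
  hf.integrable_mul hg.star

theorem re_integral {X : Type*} [MeasurableSpace X] {μ : Measure X} {f : X → ℂ}
    (hf : Integrable f μ) : (∫ x, f x ∂μ).re = ∫ x, (f x).re ∂μ :=
  (integral_re hf).symm

theorem re_integral_mul_conj (f g : L2 Ω) :
    (∫ x in (Ω : Set (Space d)), f x * conj (g x)).re = inner ℝ f g := by
  rw [re_integral (integrable_mul_conj (Lp.memLp f) (Lp.memLp g)), L2.inner_def]
  refine integral_congr_ae (.of_forall fun x => ?_)
  simp [Complex.inner, mul_comm]

theorem innerL2_eq (u v : H10 Ω) : innerL2 u v = inner ℝ (u : Jet Ω).fst (v : Jet Ω).fst :=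
  re_integral_mul_conj _ _

theorem innerH10_eq (u v : H10 Ω) : innerH10 u v = inner ℝ (u : Jet Ω).snd (v : Jet Ω).snd := by
  rw [innerH10, integral_finsetSum _ fun j _ =>
    integrable_mul_conj (pd_memLp u j) (pd_memLp v j), Complex.re_sum, PiLp.inner_apply]
  exact Finset.sum_congr rfl fun j _ => re_integral_mul_conj _ _

/-- The seminorm `‖u‖_{L²}` on `H¹₀(Ω)`. -/
def nrm0 (u : H10 Ω) : ℝ := ‖(u : Jet Ω).fst‖

/-- The seminorm `‖∇u‖_{L²}` on `H¹₀(Ω)`. -/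
def nrm1 (u : H10 Ω) : ℝ := ‖(u : Jet Ω).snd‖

theorem nrm0_nonneg (u : H10 Ω) : 0 ≤ nrm0 u := norm_nonneg _

theorem nrm1_nonneg (u : H10 Ω) : 0 ≤ nrm1 u := norm_nonneg _

theorem innerL2_self (u : H10 Ω) : innerL2 u u = nrm0 u ^ 2 := by
  rw [innerL2_eq, real_inner_self_eq_norm_sq, nrm0]

theorem innerH10_self (u : H10 Ω) : innerH10 u u = nrm1 u ^ 2 := by
  rw [innerH10_eq, real_inner_self_eq_norm_sq, nrm1]

theorem norm_sq_eq (u : H10 Ω) : ‖u‖ ^ 2 = nrm0 u ^ 2 + nrm1 u ^ 2 :=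
  WithLp.prod_norm_sq_eq_of_L2 (u : Jet Ω)

theorem nrm0_le (u : H10 Ω) : nrm0 u ≤ ‖u‖ :=
  abs_le_of_sq_le_sq' (by nlinarith [norm_sq_eq u, sq_nonneg (nrm1 u)]) (norm_nonneg _) |>.2

theorem nrm1_le (u : H10 Ω) : nrm1 u ≤ ‖u‖ :=
  abs_le_of_sq_le_sq' (by nlinarith [norm_sq_eq u, sq_nonneg (nrm0 u)]) (norm_nonneg _) |>.2

theorem eLpNorm_fn (u : H10 Ω) :
    eLpNorm (fn u) 2 (volume.restrict (Ω : Set (Space d))) = ENNReal.ofReal (nrm0 u) := by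
  rw [nrm0, Lp.norm_def, ENNReal.ofReal_toReal (Lp.eLpNorm_ne_top _)]
  rfl

theorem eLpNorm_pd_le (u : H10 Ω) (j : Fin d) :
    eLpNorm (pd u j) 2 (volume.restrict (Ω : Set (Space d))) ≤ ENNReal.ofReal (nrm1 u) := by
  refine le_trans (le_of_eq ?_) (ENNReal.ofReal_le_ofReal (PiLp.norm_apply_le (u : Jet Ω).snd j))
  rw [Lp.norm_def, ENNReal.ofReal_toReal (Lp.eLpNorm_ne_top _)]
  rfl

instance : CompleteSpace (H10 Ω) :=
  (testJets Ω).isClosed_topologicalClosure.completeSpace_coe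

/-! ### The two-component space -/

theorem waveInnerL2_self (u : Wave Ω) : waveInnerL2 u u = ∑ i, nrm0 (u i) ^ 2 := by
  simp only [waveInnerL2, innerL2_self]

theorem waveInnerH10_self (u : Wave Ω) : waveInnerH10 u u = ∑ i, nrm1 (u i) ^ 2 := by
  simp only [waveInnerH10, innerH10_self]

theorem normL2_sq (u : Wave Ω) : normL2 u ^ 2 = ∑ i, nrm0 (u i) ^ 2 := by
  rw [normL2, waveInnerL2_self, Real.sq_sqrt (Finset.sum_nonneg fun i _ => sq_nonneg _)]

theorem normH10_sq (u : Wave Ω) : normH10 u ^ 2 = ∑ i, nrm1 (u i) ^ 2 := by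
  rw [normH10, waveInnerH10_self, Real.sq_sqrt (Finset.sum_nonneg fun i _ => sq_nonneg _)]

theorem normL2_nonneg (u : Wave Ω) : 0 ≤ normL2 u := Real.sqrt_nonneg _

theorem normH10_nonneg (u : Wave Ω) : 0 ≤ normH10 u := Real.sqrt_nonneg _

theorem wave_norm_sq (u : Wave Ω) : ‖u‖ ^ 2 = normL2 u ^ 2 + normH10 u ^ 2 := by
  rw [normL2_sq, normH10_sq, PiLp.norm_sq_eq_of_L2, ← Finset.sum_add_distrib]
  exact Finset.sum_congr rfl fun i _ => norm_sq_eq _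

theorem nrm0_le_normL2 (u : Wave Ω) (i : Fin 2) : nrm0 (u i) ≤ normL2 u := by
  refine abs_le_of_sq_le_sq' ?_ (normL2_nonneg _) |>.2
  rw [normL2_sq]
  exact Finset.single_le_sum (f := fun i => nrm0 (u i) ^ 2) (fun i _ => sq_nonneg _)
    (Finset.mem_univ i)

theorem nrm1_le_normH10 (u : Wave Ω) (i : Fin 2) : nrm1 (u i) ≤ normH10 u := by
  refine abs_le_of_sq_le_sq' ?_ (normH10_nonneg _) |>.2
  rw [normH10_sq]
  exact Finset.single_le_sum (f := fun i => nrm1 (u i) ^ 2) (fun i _ => sq_nonneg _)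
    (Finset.mem_univ i)

theorem waveInnerL2_comm (u v : Wave Ω) : waveInnerL2 u v = waveInnerL2 v u := by
  simp only [waveInnerL2, innerL2_eq]
  exact Finset.sum_congr rfl fun i _ => real_inner_comm _ _

theorem innerL2_comm (u v : H10 Ω) : innerL2 u v = innerL2 v u := by
  rw [innerL2_eq, innerL2_eq, real_inner_comm]

theorem innerH10_comm (u v : H10 Ω) : innerH10 u v = innerH10 v u := by
  rw [innerH10_eq, innerH10_eq, real_inner_comm]

theorem innerL2_smul_left (c : ℝ) (u v : H10 Ω) : innerL2 (c • u) v = c * innerL2 u v := by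
  simp only [innerL2_eq]
  exact real_inner_smul_left _ _ _

theorem waveInnerL2_smul_left (c : ℝ) (u v : Wave Ω) :
    waveInnerL2 (c • u) v = c * waveInnerL2 u v := by
  simp only [waveInnerL2, PiLp.smul_apply, innerL2_smul_left, Finset.mul_sum]

theorem abs_innerL2_le (u v : H10 Ω) : |innerL2 u v| ≤ nrm0 u * nrm0 v := by
  rw [innerL2_eq]
  exact abs_real_inner_le_norm _ _

theorem normL2_smul (c : ℝ) (u : Wave Ω) : normL2 (c • u) = |c| * normL2 u := by
  rw [normL2, waveInnerL2_smul_left, waveInnerL2_comm, waveInnerL2_smul_left, ← mul_assoc,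
    Real.sqrt_mul (mul_self_nonneg c), Real.sqrt_mul_self_eq_abs, normL2]

/-! ### Density of the test functions -/

theorem dense_testJets : Dense {u : H10 Ω | (u : Jet Ω) ∈ testJets Ω} := by
  intro u
  rw [closure_subtype]
  have himg : (Subtype.val '' {u : H10 Ω | (u : Jet Ω) ∈ testJets Ω} : Set (Jet Ω))
      = (testJets Ω : Set (Jet Ω)) := by
    ext w
    exact ⟨by rintro ⟨v, hv, rfl⟩; exact hv,
      fun hw => ⟨⟨w, (testJets Ω).le_topologicalClosure hw⟩, hw, rfl⟩⟩
  rw [himg]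
  exact u.2

/-! ### The Sobolev inequality `‖u‖_{L⁶} ≤ C ‖∇u‖_{L²}` -/

theorem norm_clm_le_sum (A : Space d →L[ℝ] ℂ) :
    ‖A‖ ≤ ∑ j, ‖A (EuclideanSpace.single j 1)‖ := by
  refine A.opNorm_le_bound (Finset.sum_nonneg fun _ _ => norm_nonneg _) fun x => ?_
  have hx : A x = ∑ j, x j • A (EuclideanSpace.single j 1) := by
    conv_lhs => rw [← (EuclideanSpace.basisFun (Fin d) ℝ).sum_repr x]
    simp [map_sum]
  rw [hx, Finset.sum_mul]
  refine (norm_sum_le _ _).trans (Finset.sum_le_sum fun j _ => ?_)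
  rw [norm_smul, mul_comm]
  exact mul_le_mul_of_nonneg_left (PiLp.norm_apply_le x j) (norm_nonneg _)

/-- The Sobolev inequality for test functions. In dimension 2, where the exponent `2` is critical,
the Gagliardo-Nirenberg-Sobolev inequality is used with the exponent `3/2`, and Hölder's inequality
on the bounded set `Ω` does the rest. -/
theorem exists_eLpNorm_six_le_of_test (hd : d = 2 ∨ d = 3)
    (hΩ : Bornology.IsBounded (Ω : Set (Space d))) :
    ∃ C : NNReal, ∀ u : H10 Ω, (u : Jet Ω) ∈ testJets Ω →
      eLpNorm (fn u) 6 (volume.restrict (Ω : Set (Space d))) ≤ C * ENNReal.ofReal (nrm1 u) := by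
  obtain ⟨p, hp1, hp2, hpd, hp6⟩ : ∃ p : NNReal, 1 ≤ p ∧ p ≤ 2 ∧ p < (d : NNReal) ∧
      (p : ℝ)⁻¹ - (d : ℝ)⁻¹ ≤ ((6 : NNReal) : ℝ)⁻¹ := by
    rcases hd with rfl | rfl
    · refine ⟨3 / 2, ?_, ?_, ?_, by norm_num⟩
      · rw [← NNReal.coe_le_coe]; norm_num
      · rw [← NNReal.coe_le_coe]; norm_num
      · rw [← NNReal.coe_lt_coe]; norm_num
    · refine ⟨2, ?_, le_rfl, ?_, by norm_num⟩ <;> norm_num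
  set μ := volume.restrict (Ω : Set (Space d)) with hμ
  have : IsFiniteMeasure μ := ⟨by
    rw [hμ, Measure.restrict_apply_univ]; exact hΩ.measure_lt_top⟩
  set a := μ Set.univ ^ (1 / (p : ENNReal).toReal - 1 / (2 : ENNReal).toReal) with ha
  have ha_top : a ≠ ⊤ := by
    refine ENNReal.rpow_ne_top_of_nonneg ?_ (measure_ne_top _ _)
    rw [sub_nonneg]
    refine one_div_le_one_div_of_le ?_ ?_
    · simpa using lt_of_lt_of_le one_pos hp1
    · simpa using NNReal.coe_le_coe.mpr hp2
  set S := eLpNormLESNormFDerivOfLeConst ℂ (volume : Measure (Space d)) (Ω : Set (Space d)) p 6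
  refine ⟨S * a.toNNReal * d, fun u ⟨φ, h0, h1⟩ => ?_⟩
  have hφ : ContDiff ℝ 1 φ := φ.contDiff.of_le (by simp)
  have hdφ : Function.support (fderiv ℝ φ) ⊆ (Ω : Set (Space d)) :=
    (support_fderiv_subset ℝ).trans φ.tsupport_subset
  have hmeas : ∀ j, AEStronglyMeasurable
      (fun x => fderiv ℝ φ x (EuclideanSpace.single j 1)) μ := fun j =>
    ((hφ.continuous_fderiv one_ne_zero).clm_apply continuous_const).aestronglyMeasurable
  have hgrad : eLpNorm (fderiv ℝ φ) 2 μ ≤ d * ENNReal.ofReal (nrm1 u) := by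
    calc eLpNorm (fderiv ℝ φ) 2 μ
        ≤ eLpNorm (∑ j, fun x => ‖fderiv ℝ φ x (EuclideanSpace.single j 1)‖) 2 μ := by
          refine eLpNorm_mono_real fun x => ?_
          rw [Finset.sum_apply]
          exact norm_clm_le_sum _
      _ ≤ ∑ j, eLpNorm (fun x => ‖fderiv ℝ φ x (EuclideanSpace.single j 1)‖) 2 μ :=
          eLpNorm_sum_le (fun j _ => (hmeas j).norm) (by norm_num)
      _ ≤ ∑ _j : Fin d, ENNReal.ofReal (nrm1 u) := by
          refine Finset.sum_le_sum fun j _ => ?_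
          rw [eLpNorm_norm, ← eLpNorm_congr_ae (h1 j)]
          exact eLpNorm_pd_le u j
      _ = d * ENNReal.ofReal (nrm1 u) := by simp
  calc eLpNorm (fn u) 6 μ = eLpNorm φ 6 μ := eLpNorm_congr_ae h0
    _ ≤ eLpNorm φ 6 volume := eLpNorm_mono_measure _ Measure.restrict_le_self
    _ ≤ S * eLpNorm (fderiv ℝ φ) p volume := by
        have h := eLpNorm_le_eLpNorm_fderiv_of_le (volume : Measure (Space d)) hφ
          ((subset_tsupport φ).trans φ.tsupport_subset) (p := p) (q := 6) hp1
          (by simpa using hpd) (by simpa using hp6) hΩ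
        exact h
    _ = S * eLpNorm (fderiv ℝ φ) p μ := by
        have h := eLpNorm_restrict_eq_of_support_subset (ε := Space d →L[ℝ] ℂ)
          (μ := volume) (p := p) (f := fderiv ℝ φ) hdφ
        rw [← h]
    _ ≤ S * (eLpNorm (fderiv ℝ φ) 2 μ * a) := by
        gcongr
        exact eLpNorm_le_eLpNorm_mul_rpow_measure_univ (by exact_mod_cast hp2)
          (hφ.continuous_fderiv one_ne_zero).aestronglyMeasurable
    _ ≤ S * (d * ENNReal.ofReal (nrm1 u) * a) := by gcongr
    _ = (S * a.toNNReal * d : NNReal) * ENNReal.ofReal (nrm1 u) := by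
        push_cast
        rw [ENNReal.coe_toNNReal ha_top]
        ring

theorem exists_eLpNorm_six_le (hd : d = 2 ∨ d = 3)
    (hΩ : Bornology.IsBounded (Ω : Set (Space d))) :
    ∃ C : NNReal, ∀ u : H10 Ω,
      eLpNorm (fn u) 6 (volume.restrict (Ω : Set (Space d))) ≤ ENNReal.ofReal (C * nrm1 u) := by
  obtain ⟨C, hC⟩ := exists_eLpNorm_six_le_of_test hd hΩ
  refine ⟨C, fun u => ?_⟩
  obtain ⟨w, hw, hlim⟩ := mem_closure_iff_seq_limit.mp (dense_testJets u)
  have hJ : Filter.Tendsto (fun n => ((w n : H10 Ω) : Jet Ω)) Filter.atTop (nhds (u : Jet Ω)) :=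
    (continuous_subtype_val.tendsto u).comp hlim
  have h0 : Filter.Tendsto (fun n => ((w n : H10 Ω) : Jet Ω).fst) Filter.atTop
      (nhds (u : Jet Ω).fst) :=
    ((WithLp.prod_continuous_ofLp 2 _ _).fst.tendsto _).comp hJ
  have h1 : Filter.Tendsto (fun n => nrm1 (w n)) Filter.atTop (nhds (nrm1 u)) :=
    ((WithLp.prod_continuous_ofLp 2 _ _).snd.norm.tendsto _).comp hJ
  -- A subsequence converges almost everywhere, and Fatou's lemma applies to it.
  obtain ⟨ns, hns, hae⟩ := (tendstoInMeasure_of_tendsto_Lp h0).exists_seq_tendsto_ae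
  refine (Lp.eLpNorm_lim_le_liminf_eLpNorm
    (fun n => (fn_memLp (w (ns n))).aestronglyMeasurable) (fn u) hae).trans ?_
  refine (Filter.liminf_le_liminf (v := fun n => ENNReal.ofReal (C * nrm1 (w (ns n))))
    (.of_forall fun n => ?_)).trans (le_of_eq ?_)
  · rw [ENNReal.ofReal_mul C.coe_nonneg, ENNReal.ofReal_coe_nnreal]
    exact hC _ (hw _)
  · exact (ENNReal.tendsto_ofReal ((h1.comp hns.tendsto_atTop).const_mul (C : ℝ))).liminf_eq

/-! ### Cubic and quartic products -/

/-- `C` is a constant in the Sobolev inequality `‖u‖_{L⁶} ≤ C ‖∇u‖_{L²}` on `H¹₀(Ω)`. -/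
def IsSobolevConst (Ω : Opens (Space d)) (C : NNReal) : Prop :=
  ∀ u : H10 Ω,
    eLpNorm (fn u) 6 (volume.restrict (Ω : Set (Space d))) ≤ ENNReal.ofReal (C * nrm1 u)

theorem holderTriple_six_six : ENNReal.HolderTriple 6 6 3 where
  inv_add_inv_eq_inv := by
    rw [← two_mul, show (6 : ENNReal) = 2 * 3 by norm_num,
      ENNReal.mul_inv (by simp) (by simp), ← mul_assoc,
      ENNReal.mul_inv_cancel (by simp) (by simp), one_mul]

theorem holderTriple_three_six : ENNReal.HolderTriple 3 6 2 where
  inv_add_inv_eq_inv := by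
    have h6 : (6 : ENNReal)⁻¹ = 2⁻¹ * 3⁻¹ := by
      rw [show (6 : ENNReal) = 2 * 3 by norm_num, ENNReal.mul_inv (by simp) (by simp)]
    have h3 : (3 : ENNReal)⁻¹ = 2 * 6⁻¹ := by
      rw [h6, ← mul_assoc, ENNReal.mul_inv_cancel (by simp) (by simp), one_mul]
    have h2 : (2 : ENNReal)⁻¹ = 3 * 6⁻¹ := by
      rw [h6, mul_comm, mul_assoc, ENNReal.inv_mul_cancel (by simp) (by simp), mul_one]
    rw [h2, h3]
    ring

theorem eLpNorm_mul_le {X : Type*} [MeasurableSpace X] {μ : Measure X} {f g : X → ℂ}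
    {p q r : ENNReal} (hpqr : ENNReal.HolderTriple p q r) (hf : AEStronglyMeasurable f μ)
    (hg : AEStronglyMeasurable g μ) :
    eLpNorm (f * g) r μ ≤ eLpNorm f p μ * eLpNorm g q μ := by
  have h := eLpNorm_smul_le_mul_eLpNorm (p := p) (q := q) (r := r) hg hf
  exact h

theorem eLpNorm_cubic_le {C : NNReal} (hC : IsSobolevConst Ω C) (u v w : H10 Ω) :
    eLpNorm (fn u * fn v * fn w) 2 (volume.restrict (Ω : Set (Space d))) ≤
      ENNReal.ofReal (C ^ 3 * (nrm1 u * nrm1 v * nrm1 w)) := by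
  have hm := fun z : H10 Ω => (fn_memLp z).aestronglyMeasurable
  have h1 := eLpNorm_mul_le holderTriple_three_six ((hm u).mul (hm v)) (hm w)
  have h2 := eLpNorm_mul_le holderTriple_six_six (hm u) (hm v)
  refine (h1.trans (mul_le_mul' (h2.trans (mul_le_mul' (hC u) (hC v))) (hC w))).trans
    (le_of_eq ?_)
  have h := fun z : H10 Ω => mul_nonneg C.coe_nonneg (nrm1_nonneg z)
  rw [← ENNReal.ofReal_mul (h u), ← ENNReal.ofReal_mul (mul_nonneg (h u) (h v))]
  congr 1
  ring

theorem memLp_cubic {C : NNReal} (hC : IsSobolevConst Ω C) (u v w : H10 Ω) :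
    MemLp (fn u * fn v * fn w) 2 (volume.restrict (Ω : Set (Space d))) :=
  ⟨((fn_memLp u).aestronglyMeasurable.mul (fn_memLp v).aestronglyMeasurable).mul
    (fn_memLp w).aestronglyMeasurable, (eLpNorm_cubic_le hC u v w).trans_lt ENNReal.ofReal_lt_top⟩

theorem integral_norm_mul_norm_le {X : Type*} [MeasurableSpace X] {μ : Measure X} {f g : X → ℂ}
    (hf : MemLp f 2 μ) (hg : MemLp g 2 μ) :
    ∫ x, ‖f x‖ * ‖g x‖ ∂μ ≤ (eLpNorm f 2 μ).toReal * (eLpNorm g 2 μ).toReal := by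
  have h := integral_mul_norm_le_Lp_mul_Lq (μ := μ) (f := f) (g := g)
    Real.HolderConjugate.two_two (by simpa using hf) (by simpa using hg)
  refine h.trans (le_of_eq ?_)
  rw [hf.eLpNorm_eq_integral_rpow_norm (by simp) (by simp),
    hg.eLpNorm_eq_integral_rpow_norm (by simp) (by simp),
    ENNReal.toReal_ofReal (by positivity), ENNReal.toReal_ofReal (by positivity)]
  simp

theorem abs_re_integral_mul_conj_le {X : Type*} [MeasurableSpace X] {μ : Measure X} {f g : X → ℂ}
    (hf : MemLp f 2 μ) (hg : MemLp g 2 μ) :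
    |(∫ x, f x * conj (g x) ∂μ).re| ≤ (eLpNorm f 2 μ).toReal * (eLpNorm g 2 μ).toReal := by
  refine (Complex.abs_re_le_norm _).trans ((norm_integral_le_integral_norm _).trans ?_)
  refine le_trans (le_of_eq ?_) (integral_norm_mul_norm_le hf hg)
  simp

theorem integrable_quartic {C : NNReal} (hC : IsSobolevConst Ω C) (w u : H10 Ω) :
    Integrable (fun x => ‖fn w x‖ ^ 2 * ‖fn u x‖ ^ 2)
      (volume.restrict (Ω : Set (Space d))) := by
  refine ((memLp_cubic hC w w u).norm.integrable_mul (fn_memLp u).norm).congr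
    (.of_forall fun x => ?_)
  simp only [Pi.mul_apply, norm_mul]
  ring

/-- The quartic terms are controlled with only one power of `‖∇u‖`, which makes them small compared
with `‖∇u‖²` up to a multiple of `‖u‖²`. -/
theorem integral_quartic_le {C : NNReal} (hC : IsSobolevConst Ω C) (w u : H10 Ω) :
    ∫ x in (Ω : Set (Space d)), ‖fn w x‖ ^ 2 * ‖fn u x‖ ^ 2 ≤
      C ^ 3 * (nrm1 w ^ 2 * nrm1 u) * nrm0 u := by
  have h := integral_norm_mul_norm_le (memLp_cubic hC w w u) (fn_memLp u)
  rw [eLpNorm_fn, ENNReal.toReal_ofReal (nrm0_nonneg u)] at h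
  have h3 : (eLpNorm (fn w * fn w * fn u) 2 (volume.restrict (Ω : Set (Space d)))).toReal ≤
      C ^ 3 * (nrm1 w ^ 2 * nrm1 u) := by
    have hw := nrm1_nonneg w
    have hu := nrm1_nonneg u
    refine ENNReal.toReal_le_of_le_ofReal (by positivity) ?_
    rw [sq (nrm1 w)]
    exact eLpNorm_cubic_le hC w w u
  refine le_trans (le_of_eq ?_) (h.trans (mul_le_mul_of_nonneg_right h3 (nrm0_nonneg u)))
  refine integral_congr_ae (.of_forall fun x => ?_)
  simp only [Pi.mul_apply, norm_mul]
  ring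

/-! ### Operators from `H¹₀(Ω)` to `L²(Ω)` -/

/-- A map from `H¹₀(Ω)` to functions on `Ω` that is bounded into `L²(Ω)`. -/
def L2Bounded (T : H10 Ω → Space d → ℂ) : Prop :=
  ∃ M : NNReal, ∀ u, AEStronglyMeasurable (T u) (volume.restrict (Ω : Set (Space d))) ∧
    eLpNorm (T u) 2 (volume.restrict (Ω : Set (Space d))) ≤ M * ENNReal.ofReal ‖u‖

namespace L2Bounded

variable {S T : H10 Ω → Space d → ℂ}

theorem memLp (hT : L2Bounded T) (u : H10 Ω) :
    MemLp (T u) 2 (volume.restrict (Ω : Set (Space d))) := by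
  obtain ⟨M, hM⟩ := hT
  exact ⟨(hM u).1, (hM u).2.trans_lt (ENNReal.mul_lt_top ENNReal.coe_lt_top ENNReal.ofReal_lt_top)⟩

theorem of_fn : L2Bounded (fn (Ω := Ω)) :=
  ⟨1, fun u => ⟨(fn_memLp u).1, by
    rw [eLpNorm_fn, ENNReal.coe_one, one_mul]
    exact ENNReal.ofReal_le_ofReal (nrm0_le u)⟩⟩

theorem of_pd (j : Fin d) : L2Bounded (fun u : H10 Ω => pd u j) :=
  ⟨1, fun u => ⟨(pd_memLp u j).1, by
    rw [ENNReal.coe_one, one_mul]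
    exact (eLpNorm_pd_le u j).trans (ENNReal.ofReal_le_ofReal (nrm1_le u))⟩⟩

theorem of_cubic {C : NNReal} (hC : IsSobolevConst Ω C) (w : H10 Ω) :
    L2Bounded (fun (u : H10 Ω) x => ((‖fn w x‖ ^ 2 : ℝ) : ℂ) * fn u x) := by
  refine ⟨C ^ 3 * (nrm1 w * nrm1 w).toNNReal, fun u => ⟨?_, ?_⟩⟩
  · exact (Complex.continuous_ofReal.comp_aestronglyMeasurable
      ((fn_memLp w).aestronglyMeasurable.norm.pow 2)).mul (fn_memLp u).aestronglyMeasurable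
  · rw [eLpNorm_congr_norm_ae (g := fn w * fn w * fn u) (.of_forall fun x => by simp [sq])]
    refine (eLpNorm_cubic_le hC w w u).trans (le_of_eq_of_le ?_ (mul_le_mul_right
      (ENNReal.ofReal_le_ofReal (nrm1_le u)) _))
    rw [← mul_assoc, ENNReal.ofReal_mul (by have := nrm1_nonneg w; positivity),
      ENNReal.ofReal_mul (by positivity), ENNReal.coe_mul, ← NNReal.coe_pow,
      ENNReal.ofReal_coe_nnreal]
    rfl

theorem add (hS : L2Bounded S) (hT : L2Bounded T) :
    L2Bounded (fun u x => S u x + T u x) := by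
  obtain ⟨M, hM⟩ := hS
  obtain ⟨N, hN⟩ := hT
  refine ⟨M + N, fun u => ⟨(hM u).1.add (hN u).1, ?_⟩⟩
  refine (eLpNorm_add_le (hM u).1 (hN u).1 (by norm_num)).trans ?_
  rw [ENNReal.coe_add, add_mul]
  exact add_le_add (hM u).2 (hN u).2

theorem bdd_mul (hT : L2Bounded T) {c : Space d → ℂ}
    (hc : MemLp c ⊤ (volume.restrict (Ω : Set (Space d)))) :
    L2Bounded (fun u x => c x * T u x) := by
  obtain ⟨M, hM⟩ := hT
  refine ⟨(eLpNorm c ⊤ (volume.restrict (Ω : Set (Space d)))).toNNReal * M,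
    fun u => ⟨hc.1.mul (hM u).1, ?_⟩⟩
  rw [ENNReal.coe_mul, ENNReal.coe_toNNReal hc.2.ne, mul_assoc]
  exact (eLpNorm_smul_le_mul_eLpNorm (hM u).1 hc.1).trans (mul_le_mul_right (hM u).2 _)

theorem const_mul (hT : L2Bounded T) (c : ℂ) : L2Bounded (fun u x => c * T u x) :=
  hT.bdd_mul (memLp_top_const c)

theorem sub (hS : L2Bounded S) (hT : L2Bounded T) :
    L2Bounded (fun u x => S u x - T u x) := by
  simpa [sub_eq_add_neg] using hS.add (hT.const_mul (-1))

theorem exists_bound (hT : L2Bounded T) : ∃ M : ℝ, ∀ u v : H10 Ω,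
    |(∫ x in (Ω : Set (Space d)), T u x * conj (fn v x)).re| ≤ M * ‖u‖ * ‖v‖ := by
  have hmem := hT.memLp
  obtain ⟨M, hM⟩ := hT
  refine ⟨M, fun u v => (abs_re_integral_mul_conj_le (hmem u) (fn_memLp v)).trans ?_⟩
  rw [eLpNorm_fn, ENNReal.toReal_ofReal (nrm0_nonneg v)]
  refine mul_le_mul ?_ (nrm0_le v) (nrm0_nonneg v) (by positivity)
  refine ENNReal.toReal_le_of_le_ofReal (by positivity) ((hM u).2.trans (le_of_eq ?_))
  rw [ENNReal.ofReal_mul M.coe_nonneg, ENNReal.ofReal_coe_nnreal]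

end L2Bounded

theorem memLp_coord (hΩ : Bornology.IsBounded (Ω : Set (Space d))) (j : Fin d) :
    MemLp (fun x : Space d => (x j : ℂ)) ⊤ (volume.restrict (Ω : Set (Space d))) := by
  obtain ⟨R, hR⟩ := hΩ.exists_norm_le
  refine memLp_top_of_bound (C := R) ?_ ?_
  · exact (by fun_prop : Continuous fun x : Space d => (x j : ℂ)).aestronglyMeasurable
  · filter_upwards [ae_restrict_mem Ω.isOpen.measurableSet] with x hx
    rw [Complex.norm_real]
    exact (PiLp.norm_apply_le x j).trans (hR x hx)

theorem l2Bounded_Lz [NeZero d] (hΩ : Bornology.IsBounded (Ω : Set (Space d))) :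
    L2Bounded (Lz (Ω := Ω)) :=
  (((L2Bounded.of_pd 1).bdd_mul (memLp_coord hΩ 0)).sub
    ((L2Bounded.of_pd 0).bdd_mul (memLp_coord hΩ 1))).const_mul (-Complex.I)

theorem l2Bounded_rho {C : NNReal} (hC : IsSobolevConst Ω C) (P : Data d) (Ψ : Wave Ω)
    (i : Fin 2) : L2Bounded (fun (u : H10 Ω) x => (rho P Ψ i x : ℂ) * fn u x) := by
  convert ((L2Bounded.of_cubic hC (Ψ 0)).const_mul (P.K i 0)).add
    ((L2Bounded.of_cubic hC (Ψ 1)).const_mul (P.K i 1)) using 3 with u x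
  simp only [rho, Fin.sum_univ_two]
  push_cast
  ring

theorem A1.memLp_V [NeZero d] {α : ℝ} {P : Data d} (hA : A1 Ω α P) (i : Fin 2) :
    MemLp (fun x => (P.V i x : ℂ)) ⊤ (volume.restrict (Ω : Set (Space d))) :=
  (hA i).1.ofReal

theorem l2Bounded_potential [NeZero d] (hΩ : Bornology.IsBounded (Ω : Set (Space d)))
    {C : NNReal} (hC : IsSobolevConst Ω C) {α : ℝ} {P : Data d} (hA : A1 Ω α P) (Ψ : Wave Ω)
    (i : Fin 2) :
    L2Bounded (fun (u : H10 Ω) x =>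
      (P.V i x : ℂ) * fn u x + (rho P Ψ i x : ℂ) * fn u x - (P.ω i : ℂ) * Lz u x) :=
  ((L2Bounded.of_fn.bdd_mul (hA.memLp_V i)).add (l2Bounded_rho hC P Ψ i)).sub
    ((l2Bounded_Lz hΩ).const_mul _)

/-! ### Symmetry of the angular momentum -/

theorem fderiv_coord_mul_conj (χ : 𝓓(Ω, ℂ)) {j k : Fin d} (hjk : j ≠ k) (x : Space d) :
    fderiv ℝ (fun y : Space d => (y j : ℂ) * conj (χ y)) x (EuclideanSpace.single k 1) =
      (x j : ℂ) * conj (fderiv ℝ χ x (EuclideanSpace.single k 1)) := by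
  have hχ : DifferentiableAt ℝ χ x := (χ.contDiff.differentiable (by simp)) x
  have h1 : HasFDerivAt (fun y : Space d => (y j : ℂ))
      (Complex.ofRealCLM.comp (EuclideanSpace.proj j : Space d →L[ℝ] ℝ)) x :=
    (Complex.ofRealCLM.comp (EuclideanSpace.proj j : Space d →L[ℝ] ℝ)).hasFDerivAt
  have h2 : HasFDerivAt (fun y : Space d => conj (χ y))
      ((Complex.conjCLE : ℂ →L[ℝ] ℂ).comp (fderiv ℝ χ x)) x :=
    (Complex.conjCLE : ℂ →L[ℝ] ℂ).hasFDerivAt.comp x hχ.hasFDerivAt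
  rw [(h1.fun_mul h2).fderiv]
  simp [hjk]

/-- Integration by parts for `x_j ∂_k` with `j ≠ k`. -/
theorem integral_coord_mul_fderiv (φ χ : 𝓓(Ω, ℂ)) {j k : Fin d} (hjk : j ≠ k) :
    ∫ x, (x j : ℂ) * fderiv ℝ φ x (EuclideanSpace.single k 1) * conj (χ x) =
      -∫ x, (x j : ℂ) * conj (fderiv ℝ χ x (EuclideanSpace.single k 1)) * φ x := by
  have hφ : ContDiff ℝ 1 φ := φ.contDiff.of_le (by simp)
  have hχ : ContDiff ℝ 1 χ := χ.contDiff.of_le (by simp)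
  have hφ' := (hφ.continuous_fderiv one_ne_zero).clm_apply
    (continuous_const (y := (EuclideanSpace.single k 1 : Space d)))
  have hχ' := (hχ.continuous_fderiv one_ne_zero).clm_apply
    (continuous_const (y := (EuclideanSpace.single k 1 : Space d)))
  have hφ0 := φ.continuous
  have hχ0 := χ.continuous
  have hc : Continuous fun x : Space d => (x j : ℂ) := by fun_prop
  have hconj := Complex.continuous_conj
  have h := integral_mul_fderiv_eq_neg_fderiv_mul_of_integrable
    (μ := (volume : Measure (Space d))) (f := fun x : Space d => (x j : ℂ) * conj (χ x)) (g := φ)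
    (v := EuclideanSpace.single k 1) ?_ ?_ ?_ ?_ ?_
  · simp only [fderiv_coord_mul_conj χ hjk] at h
    rw [← h]
    refine integral_congr_ae (.of_forall fun x => ?_)
    ring
  · simp only [fderiv_coord_mul_conj χ hjk]
    exact ((hc.mul (hconj.comp hχ')).mul hφ0).integrable_of_hasCompactSupport
      φ.hasCompactSupport.mul_left
  · refine ((hc.mul (hconj.comp hχ0)).mul hφ').integrable_of_hasCompactSupport ?_
    exact (φ.hasCompactSupport.fderiv_apply ℝ _).mul_left
  · exact ((hc.mul (hconj.comp hχ0)).mul hφ0).integrable_of_hasCompactSupport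
      φ.hasCompactSupport.mul_left
  · intro x _
    have h1 : DifferentiableAt ℝ χ x := (hχ.differentiable one_ne_zero) x
    have h2 : DifferentiableAt ℝ (fun y : Space d => (y j : ℂ)) x :=
      (Complex.ofRealCLM.comp (EuclideanSpace.proj j : Space d →L[ℝ] ℝ)).differentiableAt
    exact h2.mul ((Complex.conjCLE : ℂ →L[ℝ] ℂ).differentiableAt.comp x h1)
  · exact fun x _ => (hφ.differentiable one_ne_zero) x

theorem setIntegral_of_test (χ : 𝓓(Ω, ℂ)) {F : Space d → ℂ} (hF : ∀ x, χ x = 0 → F x = 0) :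
    ∫ x in (Ω : Set (Space d)), F x = ∫ x, F x :=
  setIntegral_eq_integral_of_forall_compl_eq_zero fun x hx =>
    hF x (image_eq_zero_of_notMem_tsupport fun h => hx (χ.tsupport_subset h))

theorem zero_ne_one_fin [NeZero d] (hd : d = 2 ∨ d = 3) : (0 : Fin d) ≠ 1 := by
  rw [Ne, Fin.ext_iff]
  rcases hd with rfl | rfl <;> simp

theorem integral_Lz_of_test [NeZero d] (hd : d = 2 ∨ d = 3) {u v : H10 Ω}
    (hu : (u : Jet Ω) ∈ testJets Ω) (hv : (v : Jet Ω) ∈ testJets Ω) :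
    ∫ x in (Ω : Set (Space d)), Lz u x * conj (fn v x) =
      conj (∫ x in (Ω : Set (Space d)), Lz v x * conj (fn u x)) := by
  have h01 : (0 : Fin d) ≠ 1 := zero_ne_one_fin hd
  obtain ⟨φ, hφ, hφ'⟩ := hu
  obtain ⟨χ, hχ, hχ'⟩ := hv
  have hφc : ContDiff ℝ 1 φ := φ.contDiff.of_le (by simp)
  have hχc : ContDiff ℝ 1 χ := χ.contDiff.of_le (by simp)
  have hint : ∀ j k : Fin d, Integrable
      (fun x => (x j : ℂ) * fderiv ℝ φ x (EuclideanSpace.single k 1) * conj (χ x)) := by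
    intro j k
    refine (((by fun_prop : Continuous fun x : Space d => (x j : ℂ)).mul
      ((hφc.continuous_fderiv one_ne_zero).clm_apply continuous_const)).mul
      (Complex.continuous_conj.comp χ.continuous)).integrable_of_hasCompactSupport ?_
    exact (φ.hasCompactSupport.fderiv_apply ℝ _).mul_left.mul_right
  have hint' : ∀ j k : Fin d, Integrable
      (fun x => (x j : ℂ) * conj (fderiv ℝ χ x (EuclideanSpace.single k 1)) * φ x) := by
    intro j k
    refine (((by fun_prop : Continuous fun x : Space d => (x j : ℂ)).mul
      (Complex.continuous_conj.comp
        ((hχc.continuous_fderiv one_ne_zero).clm_apply continuous_const))).mul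
      φ.continuous).integrable_of_hasCompactSupport ?_
    exact φ.hasCompactSupport.mul_left
  have hl : ∫ x in (Ω : Set (Space d)), Lz u x * conj (fn v x) =
      ∫ x, -Complex.I * ((x 0 : ℂ) * fderiv ℝ φ x (EuclideanSpace.single 1 1) * conj (χ x)
        - (x 1 : ℂ) * fderiv ℝ φ x (EuclideanSpace.single 0 1) * conj (χ x)) := by
    rw [← setIntegral_of_test χ (fun x hx => by simp [hx])]
    refine integral_congr_ae ?_
    filter_upwards [hφ' 0, hφ' 1, hχ] with x h0 h1 h2
    simp only [Lz, pd, fn, h0, h1, h2]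
    ring
  have hr : conj (∫ x in (Ω : Set (Space d)), Lz v x * conj (fn u x)) =
      ∫ x, Complex.I * ((x 0 : ℂ) * conj (fderiv ℝ χ x (EuclideanSpace.single 1 1)) * φ x
        - (x 1 : ℂ) * conj (fderiv ℝ χ x (EuclideanSpace.single 0 1)) * φ x) := by
    rw [← integral_conj, ← setIntegral_of_test φ (fun x hx => by simp [hx])]
    refine integral_congr_ae ?_
    filter_upwards [hχ' 0, hχ' 1, hφ] with x h0 h1 h2
    simp only [Lz, pd, fn, h0, h1, h2, map_mul, map_sub, map_neg, Complex.conj_I,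
      Complex.conj_conj, Complex.conj_ofReal]
    ring
  rw [hl, hr, integral_const_mul, integral_const_mul, integral_sub (hint 0 1) (hint 1 0),
    integral_sub (hint' 0 1) (hint' 1 0), integral_coord_mul_fderiv φ χ h01,
    integral_coord_mul_fderiv φ χ h01.symm]
  ring

/-- The form `(u, v) ↦ Re ∫ (T u) v̄` of a linear operator bounded into `L²(Ω)`, as a continuous
bilinear form. -/
theorem L2Bounded.exists_form {T : H10 Ω → Space d → ℂ} (hT : L2Bounded T)
    (hadd : ∀ u v, T (u + v) =ᵐ[volume.restrict (Ω : Set (Space d))] T u + T v)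
    (hsmul : ∀ (c : ℝ) u, T (c • u) =ᵐ[volume.restrict (Ω : Set (Space d))] c • T u) :
    ∃ B : H10 Ω →L[ℝ] H10 Ω →L[ℝ] ℝ,
      ∀ u v, B u v = (∫ x in (Ω : Set (Space d)), T u x * conj (fn v x)).re := by
  obtain ⟨M, hM⟩ := hT.exists_bound
  have hi := fun u v => integrable_mul_conj (hT.memLp u) (fn_memLp v)
  refine ⟨LinearMap.mkContinuous₂ (LinearMap.mk₂ ℝ
    (fun u v : H10 Ω => (∫ x in (Ω : Set (Space d)), T u x * conj (fn v x)).re)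
    ?_ ?_ ?_ ?_) M hM, fun u v => rfl⟩
  · intro u u' v
    rw [← Complex.add_re, ← integral_add (hi u v) (hi u' v)]
    congr 1
    refine integral_congr_ae ?_
    filter_upwards [hadd u u'] with x hx
    simp only [hx, Pi.add_apply]
    ring
  · intro c u v
    rw [smul_eq_mul, ← Complex.re_ofReal_mul, ← integral_const_mul]
    congr 1
    refine integral_congr_ae ?_
    filter_upwards [hsmul c u] with x hx
    simp only [hx, Pi.smul_apply, Complex.real_smul]
    ring
  · intro u v v'
    rw [← Complex.add_re, ← integral_add (hi u v) (hi u v')]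
    congr 1
    refine integral_congr_ae ?_
    filter_upwards [fn_add v v'] with x hx
    simp only [hx, Pi.add_apply, map_add]
    ring
  · intro c u v
    rw [smul_eq_mul, ← Complex.re_ofReal_mul, ← integral_const_mul]
    congr 1
    refine integral_congr_ae ?_
    filter_upwards [fn_smul c v] with x hx
    simp only [hx, Pi.smul_apply, Complex.real_smul, map_mul, Complex.conj_ofReal]
    ring

/-- `L_z` is symmetric on `H¹₀(Ω)`, by integration by parts for test functions and density. -/
theorem re_integral_Lz_comm [NeZero d] (hd : d = 2 ∨ d = 3)
    (hΩ : Bornology.IsBounded (Ω : Set (Space d))) (u v : H10 Ω) :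
    (∫ x in (Ω : Set (Space d)), Lz u x * conj (fn v x)).re =
      (∫ x in (Ω : Set (Space d)), Lz v x * conj (fn u x)).re := by
  obtain ⟨B, hB⟩ := (l2Bounded_Lz hΩ).exists_form Lz_add Lz_smul
  have key : ∀ p : H10 Ω × H10 Ω, B p.1 p.2 = B p.2 p.1 := by
    refine fun p => isClosed_property (dense_testJets.prod dense_testJets).denseRange_val
      (p := fun p : H10 Ω × H10 Ω => B p.1 p.2 = B p.2 p.1) ?_ ?_ p
    · exact isClosed_eq (by fun_prop) (by fun_prop)
    · rintro ⟨⟨u, v⟩, hu, hv⟩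
      change B u v = B v u
      rw [hB, hB, integral_Lz_of_test hd hu hv, Complex.conj_re]
  rw [← hB, ← hB]
  exact key (u, v)

/-! ### The Hamiltonian as a continuous symmetric bilinear form -/

theorem exists_form_innerL2 (Ω : Opens (Space d)) : ∃ B : H10 Ω →L[ℝ] H10 Ω →L[ℝ] ℝ,
    ∀ u v, B u v = innerL2 u v :=
  L2Bounded.of_fn.exists_form fn_add fn_smul

theorem exists_form_waveInnerL2 (Ω : Opens (Space d)) : ∃ B : Wave Ω →L[ℝ] Wave Ω →L[ℝ] ℝ,
    ∀ u v, B u v = waveInnerL2 u v := by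
  obtain ⟨J, hJ⟩ := exists_form_innerL2 Ω
  refine ⟨∑ i, J.bilinearComp (PiLp.proj 2 (fun _ => H10 Ω) i) (PiLp.proj 2 (fun _ => H10 Ω) i),
    fun u v => ?_⟩
  simp [waveInnerL2, hJ]

theorem integrable_norm_sq {X : Type*} [MeasurableSpace X] {μ : Measure X} {f : X → ℂ}
    (hf : MemLp f 2 μ) : Integrable (fun x => ‖f x‖ ^ 2) μ :=
  hf.integrable_norm_pow (by norm_num)

theorem integrable_rho_mul {C : NNReal} (hC : IsSobolevConst Ω C) (P : Data d)
    (Ψ u : Wave Ω) (i : Fin 2) :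
    Integrable (fun x => rho P Ψ i x * ‖fn (u i) x‖ ^ 2)
      (volume.restrict (Ω : Set (Space d))) := by
  simp only [rho, Finset.sum_mul, mul_assoc]
  exact integrable_finsetSum _ fun j _ => (integrable_quartic hC (Ψ j) (u i)).const_mul _

section Hamiltonian

variable [NeZero d] {C : NNReal} {α : ℝ} {P : Data d}

theorem hamiltonianDiag_eq (hΩ : Bornology.IsBounded (Ω : Set (Space d)))
    (hC : IsSobolevConst Ω C) (hA : A1 Ω α P) (Ψ : Wave Ω) (i : Fin 2) (u v : H10 Ω) :
    hamiltonianDiag P Ψ i u v = (1 / 2) * innerH10 u v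
      + (∫ x in (Ω : Set (Space d)), ((P.V i x : ℂ) * fn u x + (rho P Ψ i x : ℂ) * fn u x
          - (P.ω i : ℂ) * Lz u x) * conj (fn v x)).re := by
  have h1 : Integrable (fun x => ∑ j, pd u j x * conj (pd v j x))
      (volume.restrict (Ω : Set (Space d))) :=
    integrable_finsetSum _ fun j _ => integrable_mul_conj (pd_memLp u j) (pd_memLp v j)
  have h2 := integrable_mul_conj ((l2Bounded_potential hΩ hC hA Ψ i).memLp u) (fn_memLp v)
  have h3 : (1 / 2 : ℝ) * innerH10 u v =
      (∫ x in (Ω : Set (Space d)), (1 / 2 : ℂ) * ∑ j, pd u j x * conj (pd v j x)).re := by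
    rw [integral_const_mul, innerH10, ← Complex.re_ofReal_mul]
    norm_num
  rw [h3, ← Complex.add_re, ← integral_add (h1.const_mul _) h2, hamiltonianDiag]
  congr 1
  refine integral_congr_ae (.of_forall fun x => ?_)
  ring

theorem hamiltonianDiag_comm (hd : d = 2 ∨ d = 3)
    (hΩ : Bornology.IsBounded (Ω : Set (Space d)))
    (hC : IsSobolevConst Ω C) (hA : A1 Ω α P) (Ψ : Wave Ω) (i : Fin 2) (u v : H10 Ω) :
    hamiltonianDiag P Ψ i u v = hamiltonianDiag P Ψ i v u := by
  have hp := fun u : H10 Ω =>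
    ((L2Bounded.of_fn.bdd_mul (hA.memLp_V i)).add (l2Bounded_rho hC P Ψ i)).memLp u
  have split : ∀ u v : H10 Ω,
      (∫ x in (Ω : Set (Space d)), ((P.V i x : ℂ) * fn u x + (rho P Ψ i x : ℂ) * fn u x
          - (P.ω i : ℂ) * Lz u x) * conj (fn v x)).re =
      (∫ x in (Ω : Set (Space d)), (P.V i x + rho P Ψ i x) * (fn u x * conj (fn v x)).re)
        - P.ω i * (∫ x in (Ω : Set (Space d)), Lz u x * conj (fn v x)).re := by
    intro u v
    have h1 := integrable_mul_conj (hp u) (fn_memLp v)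
    have h2 := integrable_mul_conj ((l2Bounded_Lz hΩ).memLp u) (fn_memLp v)
    rw [← Complex.re_ofReal_mul, ← integral_const_mul]
    have h3 : ∫ x in (Ω : Set (Space d)), (P.V i x + rho P Ψ i x) * (fn u x * conj (fn v x)).re =
        (∫ x in (Ω : Set (Space d)),
          ((P.V i x : ℂ) * fn u x + (rho P Ψ i x : ℂ) * fn u x) * conj (fn v x)).re := by
      rw [re_integral h1]
      refine integral_congr_ae (.of_forall fun x => ?_)
      beta_reduce
      rw [← Complex.re_ofReal_mul]
      congr 1
      push_cast
      ring
    rw [h3, ← Complex.sub_re, ← integral_sub h1 (h2.const_mul _)]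
    congr 1
    refine integral_congr_ae (.of_forall fun x => ?_)
    ring
  rw [hamiltonianDiag_eq hΩ hC hA, hamiltonianDiag_eq hΩ hC hA, innerH10_comm u v, split, split,
    re_integral_Lz_comm hd hΩ u v]
  congr 3
  ext x
  have : (fn v x * conj (fn u x)) = conj (fn u x * conj (fn v x)) := by simp [mul_comm]
  rw [this, Complex.conj_re]

theorem hamiltonian_comm (hd : d = 2 ∨ d = 3)
    (hΩ : Bornology.IsBounded (Ω : Set (Space d)))
    (hC : IsSobolevConst Ω C) (hA : A1 Ω α P) (Ψ u v : Wave Ω) :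
    hamiltonian P Ψ u v = hamiltonian P Ψ v u := by
  simp only [hamiltonian, fun i => hamiltonianDiag_comm hd hΩ hC hA Ψ i (u i) (v i)]
  rw [innerL2_comm (u 0), innerL2_comm (u 1)]
  ring

theorem exists_form_hamiltonianDiag (hΩ : Bornology.IsBounded (Ω : Set (Space d)))
    (hC : IsSobolevConst Ω C) (hA : A1 Ω α P) (Ψ : Wave Ω) (i : Fin 2) :
    ∃ B : H10 Ω →L[ℝ] H10 Ω →L[ℝ] ℝ, ∀ u v, B u v = hamiltonianDiag P Ψ i u v := by
  obtain ⟨B, hB⟩ := (l2Bounded_potential hΩ hC hA Ψ i).exists_form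
    (fun u v => by
      filter_upwards [fn_add u v, Lz_add u v] with x h1 h2
      simp only [h1, h2, Pi.add_apply]
      ring)
    (fun c u => by
      filter_upwards [fn_smul c u, Lz_smul c u] with x h1 h2
      simp only [h1, h2, Pi.smul_apply, Complex.real_smul]
      ring)
  obtain ⟨J, hJ⟩ := exists_form_innerL2 Ω
  let I : H10 Ω →L[ℝ] H10 Ω →L[ℝ] ℝ := (innerₗ (H10 Ω)).mkContinuous₂ 1 fun u v => by
    simpa using abs_real_inner_le_norm u v
  refine ⟨(1 / 2 : ℝ) • (I - J) + B, fun u v => ?_⟩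
  have h : inner ℝ u v = innerL2 u v + innerH10 u v := by
    rw [innerL2_eq, innerH10_eq]
    exact WithLp.prod_inner_apply _ _
  rw [hamiltonianDiag_eq hΩ hC hA, ← hB]
  change (1 / 2 : ℝ) * (inner ℝ u v - J u v) + B u v = _
  rw [h, hJ]
  ring

theorem exists_form_hamiltonian (hΩ : Bornology.IsBounded (Ω : Set (Space d)))
    (hC : IsSobolevConst Ω C) (hA : A1 Ω α P) (Ψ : Wave Ω) :
    ∃ B : Wave Ω →L[ℝ] Wave Ω →L[ℝ] ℝ, ∀ u v, B u v = hamiltonian P Ψ u v := by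
  obtain ⟨J, hJ⟩ := exists_form_innerL2 Ω
  choose D hD using exists_form_hamiltonianDiag hΩ hC hA Ψ
  refine ⟨∑ i, (D i).bilinearComp (PiLp.proj 2 (fun _ => H10 Ω) i) (PiLp.proj 2 (fun _ => H10 Ω) i)
    + P.β • J.bilinearComp (PiLp.proj 2 (fun _ => H10 Ω) 0) (PiLp.proj 2 (fun _ => H10 Ω) 1)
    + P.β • J.bilinearComp (PiLp.proj 2 (fun _ => H10 Ω) 1) (PiLp.proj 2 (fun _ => H10 Ω) 0),
    fun u v => ?_⟩
  simp [hamiltonian, hJ, hD]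

/-! ### The quadratic part of the energy -/

/-- The density of the part of the energy that is quadratic in the wave function. -/
def quadDensity (P : Data d) (u : Wave Ω) (x : Space d) : ℝ :=
  (∑ i, ((1 / 2) * (∑ j, ‖pd (u i) j x‖ ^ 2) + P.V i x * ‖fn (u i) x‖ ^ 2
      - P.ω i * (conj (fn (u i) x) * Lz (u i) x).re))
    + 2 * P.β * (fn (u 0) x * conj (fn (u 1) x)).re

theorem energyDensity_eq (P : Data d) (Ψ : Wave Ω) (x : Space d) :
    energyDensity P Ψ x =
      quadDensity P Ψ x + (1 / 2) * ∑ i, rho P Ψ i x * ‖fn (Ψ i) x‖ ^ 2 := by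
  simp only [energyDensity, quadDensity, Fin.sum_univ_two]
  ring

theorem integrable_V_mul (hA : A1 Ω α P) (i : Fin 2) (u : H10 Ω) :
    Integrable (fun x => P.V i x * ‖fn u x‖ ^ 2) (volume.restrict (Ω : Set (Space d))) := by
  refine (integrable_mul_conj ((L2Bounded.of_fn.bdd_mul (hA.memLp_V i)).memLp u)
    (fn_memLp u)).re.congr (.of_forall fun x => ?_)
  simp only [RCLike.re_to_complex, mul_assoc, Complex.mul_conj, Complex.normSq_eq_norm_sq,
    ← Complex.ofReal_mul, Complex.ofReal_re]

theorem integrable_Lz (hΩ : Bornology.IsBounded (Ω : Set (Space d))) (u : H10 Ω) :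
    Integrable (fun x => (conj (fn u x) * Lz u x).re) (volume.restrict (Ω : Set (Space d))) := by
  refine (integrable_mul_conj ((l2Bounded_Lz hΩ).memLp u) (fn_memLp u)).re.congr
    (.of_forall fun x => ?_)
  simp only [RCLike.re_to_complex, mul_comm]

theorem integrable_quadDensity (hΩ : Bornology.IsBounded (Ω : Set (Space d)))
    (hA : A1 Ω α P) (u : Wave Ω) :
    Integrable (quadDensity P u) (volume.restrict (Ω : Set (Space d))) := by
  refine Integrable.add (integrable_finsetSum _ fun i _ => ((Integrable.add ?_ ?_).sub ?_)) ?_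
  · exact (integrable_finsetSum _ fun j _ => integrable_norm_sq (pd_memLp (u i) j)).const_mul _
  · exact integrable_V_mul hA i (u i)
  · exact (integrable_Lz hΩ (u i)).const_mul _
  · exact (integrable_mul_conj (fn_memLp (u 0)) (fn_memLp (u 1))).re.const_mul _

theorem integrable_energyDensity (hΩ : Bornology.IsBounded (Ω : Set (Space d)))
    (hC : IsSobolevConst Ω C) (hA : A1 Ω α P) (Ψ : Wave Ω) :
    Integrable (energyDensity P Ψ) (volume.restrict (Ω : Set (Space d))) := by
  rw [funext (energyDensity_eq P Ψ)]
  exact (integrable_quadDensity hΩ hA Ψ).add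
    ((integrable_finsetSum _ fun i _ => integrable_rho_mul hC P Ψ Ψ i).const_mul _)

theorem hamiltonianDiag_self (hΩ : Bornology.IsBounded (Ω : Set (Space d)))
    (hC : IsSobolevConst Ω C) (hA : A1 Ω α P) (Ψ : Wave Ω) (i : Fin 2) (u : H10 Ω) :
    hamiltonianDiag P Ψ i u u = ∫ x in (Ω : Set (Space d)),
      ((1 / 2) * (∑ j, ‖pd u j x‖ ^ 2) + P.V i x * ‖fn u x‖ ^ 2 + rho P Ψ i x * ‖fn u x‖ ^ 2
        - P.ω i * (conj (fn u x) * Lz u x).re) := by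
  rw [hamiltonianDiag, re_integral]
  · refine integral_congr_ae (.of_forall fun x => ?_)
    beta_reduce
    rw [Complex.sub_re, Complex.add_re, Complex.add_re, mul_assoc (P.V i x : ℂ),
      mul_assoc (rho P Ψ i x : ℂ), mul_assoc (P.ω i : ℂ), Complex.re_ofReal_mul,
      Complex.re_ofReal_mul, Complex.re_ofReal_mul, Complex.mul_conj,
      show (1 / 2 : ℂ) = ((1 / 2 : ℝ) : ℂ) by norm_num, Complex.re_ofReal_mul, Complex.re_sum]
    simp only [Complex.mul_conj, Complex.ofReal_re, Complex.normSq_eq_norm_sq]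
  · refine (((integrable_finsetSum Finset.univ fun j _ =>
      integrable_mul_conj (pd_memLp u j) (pd_memLp u j)).const_mul (1 / 2 : ℂ)).add
      (integrable_mul_conj ((l2Bounded_potential hΩ hC hA Ψ i).memLp u) (fn_memLp u))).congr
      (.of_forall fun x => ?_)
    simp only [Pi.add_apply]
    ring

theorem integrable_hamDensity (hΩ : Bornology.IsBounded (Ω : Set (Space d)))
    (hC : IsSobolevConst Ω C) (hA : A1 Ω α P) (Ψ u : Wave Ω) :
    Integrable (fun x => quadDensity P u x + ∑ i, rho P Ψ i x * ‖fn (u i) x‖ ^ 2)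
      (volume.restrict (Ω : Set (Space d))) :=
  (integrable_quadDensity hΩ hA u).add
    (integrable_finsetSum _ fun i _ => integrable_rho_mul hC P Ψ u i)

theorem hamiltonian_self (hΩ : Bornology.IsBounded (Ω : Set (Space d)))
    (hC : IsSobolevConst Ω C) (hA : A1 Ω α P) (Ψ u : Wave Ω) :
    hamiltonian P Ψ u u = ∫ x in (Ω : Set (Space d)),
      (quadDensity P u x + ∑ i, rho P Ψ i x * ‖fn (u i) x‖ ^ 2) := by
  have hi : ∀ i : Fin 2, Integrable (fun x =>
      (1 / 2) * (∑ j, ‖pd (u i) j x‖ ^ 2) + P.V i x * ‖fn (u i) x‖ ^ 2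
        + rho P Ψ i x * ‖fn (u i) x‖ ^ 2 - P.ω i * (conj (fn (u i) x) * Lz (u i) x).re)
      (volume.restrict (Ω : Set (Space d))) := fun i =>
    (((integrable_finsetSum Finset.univ fun j _ => integrable_norm_sq (pd_memLp (u i) j)).const_mul
      (1 / 2 : ℝ)).add (integrable_V_mul hA i (u i))).add (integrable_rho_mul hC P Ψ u i) |>.sub
      ((integrable_Lz hΩ (u i)).const_mul (P.ω i))
  have h01 := integrable_mul_conj (fn_memLp (u 0)) (fn_memLp (u 1))
  have h01' : Integrable (fun x => 2 * (P.β * (fn (u 0) x * conj (fn (u 1) x)).re))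
      (volume.restrict (Ω : Set (Space d))) := (h01.re.const_mul _).const_mul _
  rw [hamiltonian, innerL2_comm (u 1), add_assoc, ← two_mul, innerL2, re_integral h01,
    ← integral_const_mul, ← integral_const_mul]
  simp only [hamiltonianDiag_self hΩ hC hA]
  rw [← integral_finsetSum _ fun i _ => hi i, ← integral_add
    (integrable_finsetSum _ fun i _ => hi i) h01']
  refine integral_congr_ae (.of_forall fun x => ?_)
  simp only [quadDensity, Fin.sum_univ_two]
  ring

end Hamiltonian

/-! ### Pointwise estimates of the densities -/

theorem norm_coord_mul_sub_sq_le (a b : ℝ) (p q : ℂ) :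
    ‖(a : ℂ) * p - (b : ℂ) * q‖ ^ 2 ≤ (a ^ 2 + b ^ 2) * (‖q‖ ^ 2 + ‖p‖ ^ 2) := by
  have h : ‖(a : ℂ) * p - (b : ℂ) * q‖ ≤ |a| * ‖p‖ + |b| * ‖q‖ := by
    refine (norm_sub_le _ _).trans (le_of_eq ?_)
    simp
  have h2 : ‖(a : ℂ) * p - (b : ℂ) * q‖ ^ 2 ≤ (|a| * ‖p‖ + |b| * ‖q‖) ^ 2 :=
    pow_le_pow_left₀ (norm_nonneg _) h 2
  rw [← sq_abs a, ← sq_abs b]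
  nlinarith [sq_nonneg (|a| * ‖q‖ - |b| * ‖p‖)]

theorem norm_sq_zero_add_one_le [NeZero d] (h01 : (0 : Fin d) ≠ 1) (f : Fin d → ℂ) :
    ‖f 0‖ ^ 2 + ‖f 1‖ ^ 2 ≤ ∑ j, ‖f j‖ ^ 2 := by
  rw [← Finset.sum_pair (f := fun j => ‖f j‖ ^ 2) h01]
  exact Finset.sum_le_univ_sum_of_nonneg fun j => sq_nonneg _

/-- The rotation term is absorbed by the kinetic term and the part `(1 + α)/2 · ω² (x² + y²)` of
the potential. -/
theorem rotation_le [NeZero d] (h01 : (0 : Fin d) ≠ 1) {α : ℝ} (hα : 0 < α) (w : ℝ) (u : H10 Ω)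
    (x : Space d) :
    w * (conj (fn u x) * Lz u x).re ≤ 1 / (2 * (1 + α)) * ∑ j, ‖pd u j x‖ ^ 2
      + (1 + α) / 2 * w ^ 2 * (x 0 ^ 2 + x 1 ^ 2) * ‖fn u x‖ ^ 2 := by
  set s := ∑ j, ‖pd u j x‖ ^ 2 with hs
  set r := x 0 ^ 2 + x 1 ^ 2 with hr
  have hL : ‖Lz u x‖ ^ 2 ≤ r * s := by
    rw [Lz, norm_mul, norm_neg, Complex.norm_I, one_mul]
    exact (norm_coord_mul_sub_sq_le _ _ _ _).trans (mul_le_mul_of_nonneg_left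
      (norm_sq_zero_add_one_le h01 fun j => pd u j x) (by positivity))
  have hs0 : 0 ≤ s := Finset.sum_nonneg fun j _ => sq_nonneg _
  have hr0 : 0 ≤ r := by positivity
  have h1 : w * (conj (fn u x) * Lz u x).re ≤ |w| * ‖fn u x‖ * ‖Lz u x‖ := by
    refine (le_abs_self _).trans ?_
    rw [abs_mul, mul_assoc]
    refine mul_le_mul_of_nonneg_left ((Complex.abs_re_le_norm _).trans ?_) (abs_nonneg _)
    rw [norm_mul, RCLike.norm_conj]
  have h2 : ‖Lz u x‖ ≤ √r * √s := by
    rw [← Real.sqrt_mul hr0]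
    exact Real.le_sqrt_of_sq_le hL
  have h3 : w * (conj (fn u x) * Lz u x).re ≤ |w| * ‖fn u x‖ * (√r * √s) :=
    h1.trans (mul_le_mul_of_nonneg_left h2 (by positivity))
  have hα' : 0 < 1 + α := by linarith
  -- Young's inequality with the weight `1 + α`.
  have h4 := sq_nonneg (√s - (1 + α) * (|w| * ‖fn u x‖ * √r))
  have e1 := Real.sq_sqrt hs0
  have e2 := Real.sq_sqrt hr0
  refine h3.trans ?_
  have h5 : ∀ a b c : ℝ, 1 / (2 * (1 + α)) * a ^ 2 + (1 + α) / 2 * c ^ 2 * b ^ 2 * ‖fn u x‖ ^ 2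
      - c * ‖fn u x‖ * (b * a) = (a - (1 + α) * (c * ‖fn u x‖ * b)) ^ 2 / (2 * (1 + α)) := by
    intro a b c
    field_simp
    ring
  have h7 := h5 √s √r |w|
  rw [e1, e2, sq_abs] at h7
  have h6 := div_nonneg h4 (by positivity : 0 ≤ 2 * (1 + α))
  linarith

theorem re_mul_conj_le (β : ℝ) (a b : ℂ) :
    -(|β| * (‖a‖ ^ 2 + ‖b‖ ^ 2)) ≤ 2 * β * (a * conj b).re := by
  have h1 : |(a * conj b).re| ≤ ‖a‖ * ‖b‖ := by
    refine (Complex.abs_re_le_norm _).trans ?_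
    rw [norm_mul, RCLike.norm_conj]
  have h2 : |2 * β * (a * conj b).re| ≤ 2 * |β| * (‖a‖ * ‖b‖) := by
    rw [abs_mul, abs_mul, abs_two]
    exact mul_le_mul_of_nonneg_left h1 (by positivity)
  nlinarith [neg_le_of_abs_le h2, mul_nonneg (abs_nonneg β) (sq_nonneg (‖a‖ - ‖b‖))]

theorem quadDensity_ge [NeZero d] (hd : d = 2 ∨ d = 3) {α : ℝ} (hα : 0 < α) {P : Data d}
    (hA : A1 Ω α P) (u : Wave Ω) :
    ∀ᵐ x ∂(volume.restrict (Ω : Set (Space d))),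
      C0 α * ∑ i, ∑ j, ‖pd (u i) j x‖ ^ 2 ≤ quadDensity P u x := by
  filter_upwards [(hA 0).2, (hA 1).2] with x h0 h1
  have r := fun i => rotation_le (zero_ne_one_fin hd) hα (P.ω i) (u i) x
  have v0 := mul_le_mul_of_nonneg_right h0 (sq_nonneg ‖fn (u 0) x‖)
  have v1 := mul_le_mul_of_nonneg_right h1 (sq_nonneg ‖fn (u 1) x‖)
  have b := re_mul_conj_le P.β (fn (u 0) x) (fn (u 1) x)
  have hC : C0 α = 1 / 2 - 1 / (2 * (1 + α)) := by
    rw [C0]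
    field_simp
    ring
  simp only [quadDensity, Fin.sum_univ_two]
  rw [hC]
  linarith [r 0, r 1]

theorem C0_pos {α : ℝ} (hα : 0 < α) : 0 < C0 α := by
  unfold C0
  positivity

theorem Data.abs_K_le (P : Data d) (i j : Fin 2) : |P.K i j| ≤ P.km := by
  fin_cases i <;> fin_cases j <;> simp [Data.km]

theorem Data.km_nonneg (P : Data d) : 0 ≤ P.km := (abs_nonneg _).trans (P.abs_K_le 0 0)

theorem abs_rho_le (P : Data d) (Ψ : Wave Ω) (i : Fin 2) (x : Space d) :
    |rho P Ψ i x| ≤ P.km * ∑ j, ‖fn (Ψ j) x‖ ^ 2 := by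
  rw [rho, Finset.mul_sum]
  refine (Finset.abs_sum_le_sum_abs _ _).trans (Finset.sum_le_sum fun j _ => ?_)
  rw [abs_mul, abs_of_nonneg (sq_nonneg ‖fn (Ψ j) x‖)]
  exact mul_le_mul_of_nonneg_right (P.abs_K_le i j) (sq_nonneg _)

theorem neg_le_sum_rho_mul (P : Data d) (Ψ u : Wave Ω) (x : Space d) :
    -(P.km * ((∑ j, ‖fn (Ψ j) x‖ ^ 2) * ∑ i, ‖fn (u i) x‖ ^ 2)) ≤
      ∑ i, rho P Ψ i x * ‖fn (u i) x‖ ^ 2 := by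
  rw [← mul_assoc, Finset.mul_sum, ← Finset.sum_neg_distrib]
  refine Finset.sum_le_sum fun i _ => ?_
  rw [← neg_mul]
  exact mul_le_mul_of_nonneg_right (neg_le_of_abs_le (abs_rho_le P Ψ i x)) (sq_nonneg _)

theorem A2.sum_nonneg {P : Data d} (hA : A2 P) (a : Fin 2 → ℝ) (ha : ∀ i, 0 ≤ a i) :
    0 ≤ ∑ i, (∑ j, P.K i j * a j) * a i := by
  rcases hA.2 with h | h
  · refine (h.posSemidef.dotProduct_mulVec_nonneg a).trans (le_of_eq ?_)
    simp [dotProduct, Matrix.mulVec, mul_comm]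
  · exact Finset.sum_nonneg fun i _ =>
      mul_nonneg (Finset.sum_nonneg fun j _ => mul_nonneg (h i j) (ha j)) (ha i)

theorem A2.sum_rho_nonneg {P : Data d} (hA : A2 P) (Ψ : Wave Ω) (x : Space d) :
    0 ≤ ∑ i, rho P Ψ i x * ‖fn (Ψ i) x‖ ^ 2 :=
  hA.sum_nonneg (fun j => ‖fn (Ψ j) x‖ ^ 2) fun _ => sq_nonneg _

theorem abs_norm_sq_sub_le (a b : ℂ) : |‖a‖ ^ 2 - ‖b‖ ^ 2| ≤ ‖a - b‖ * (‖a‖ + ‖b‖) := by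
  rw [show ‖a‖ ^ 2 - ‖b‖ ^ 2 = (‖a‖ - ‖b‖) * (‖a‖ + ‖b‖) by ring, abs_mul,
    abs_of_nonneg (by positivity : 0 ≤ ‖a‖ + ‖b‖)]
  exact mul_le_mul_of_nonneg_right (abs_norm_sub_norm_le a b) (by positivity)

theorem sum_K_mul_sub_le (P : Data d) (a b : Fin 2 → ℂ) :
    ∑ i, ∑ j, P.K i j * (‖a j‖ ^ 2 - ‖b j‖ ^ 2) * (‖a i‖ ^ 2 - ‖b i‖ ^ 2) ≤
      2 * P.km * (((∑ j, ‖a j‖ ^ 2) + ∑ j, ‖b j‖ ^ 2) * ∑ i, ‖a i - b i‖ ^ 2) := by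
  have h : ∀ i, |‖a i‖ ^ 2 - ‖b i‖ ^ 2| ≤ ‖a i - b i‖ * (‖a i‖ + ‖b i‖) :=
    fun i => abs_norm_sq_sub_le _ _
  calc ∑ i, ∑ j, P.K i j * (‖a j‖ ^ 2 - ‖b j‖ ^ 2) * (‖a i‖ ^ 2 - ‖b i‖ ^ 2)
      ≤ ∑ i, ∑ j, P.km * (‖a j - b j‖ * (‖a j‖ + ‖b j‖)) * (‖a i - b i‖ * (‖a i‖ + ‖b i‖)) := by
        refine Finset.sum_le_sum fun i _ => Finset.sum_le_sum fun j _ => ?_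
        refine (le_abs_self _).trans ?_
        rw [abs_mul, abs_mul]
        have := P.km_nonneg
        gcongr
        · exact P.abs_K_le i j
        · exact h j
        · exact h i
    _ = P.km * (∑ i, ‖a i - b i‖ * (‖a i‖ + ‖b i‖)) ^ 2 := by
        simp only [Fin.sum_univ_two]
        ring
    _ ≤ P.km * ((∑ i, ‖a i - b i‖ ^ 2) * ∑ i, (‖a i‖ + ‖b i‖) ^ 2) := by
        refine mul_le_mul_of_nonneg_left ?_ P.km_nonneg
        exact Finset.sum_mul_sq_le_sq_mul_sq _ _ _
    _ ≤ P.km * ((∑ i, ‖a i - b i‖ ^ 2) * (2 * ((∑ j, ‖a j‖ ^ 2) + ∑ j, ‖b j‖ ^ 2))) := by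
        have := P.km_nonneg
        gcongr
        rw [← Finset.sum_add_distrib, Finset.mul_sum]
        exact Finset.sum_le_sum fun i _ => add_sq_le
    _ = _ := by ring

/-- The exact second order expansion of the energy around `Ψ`, pointwise; the remainder is
quadratic in the differences of the densities. -/
theorem energyDensity_sub_eq [NeZero d] {P : Data d} (hA : A2 P) (Φ Ψ : Wave Ω) (x : Space d) :
    energyDensity P Φ x - energyDensity P Ψ x =
      (quadDensity P Φ x + ∑ i, rho P Ψ i x * ‖fn (Φ i) x‖ ^ 2)
        - (quadDensity P Ψ x + ∑ i, rho P Ψ i x * ‖fn (Ψ i) x‖ ^ 2)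
        + 1 / 2 * ∑ i, ∑ j, P.K i j * (‖fn (Φ j) x‖ ^ 2 - ‖fn (Ψ j) x‖ ^ 2)
            * (‖fn (Φ i) x‖ ^ 2 - ‖fn (Ψ i) x‖ ^ 2) := by
  have hK : P.K 1 0 = P.K 0 1 := hA.1.apply 0 1
  simp only [energyDensity_eq, rho, Fin.sum_univ_two, hK]
  ring

/-! ### Estimates of the Hamiltonian and the energy -/

theorem integrable_grad (u : Wave Ω) :
    Integrable (fun x => ∑ i, ∑ j, ‖pd (u i) j x‖ ^ 2) (volume.restrict (Ω : Set (Space d))) :=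
  integrable_finsetSum _ fun i _ => integrable_finsetSum _ fun j _ =>
    integrable_norm_sq (pd_memLp (u i) j)

theorem integral_grad (u : Wave Ω) :
    ∫ x in (Ω : Set (Space d)), ∑ i, ∑ j, ‖pd (u i) j x‖ ^ 2 = normH10 u ^ 2 := by
  rw [normH10_sq, integral_finsetSum _ fun i _ => integrable_finsetSum _ fun j _ =>
    integrable_norm_sq (pd_memLp (u i) j)]
  refine Finset.sum_congr rfl fun i _ => ?_
  rw [← innerH10_self, innerH10, re_integral (integrable_finsetSum _ fun j _ =>
    integrable_mul_conj (pd_memLp (u i) j) (pd_memLp (u i) j))]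
  refine integral_congr_ae (.of_forall fun x => ?_)
  simp only [Complex.re_sum, Complex.mul_conj, Complex.ofReal_re, Complex.normSq_eq_norm_sq]

theorem integrable_wave_quartic {C : NNReal} (hC : IsSobolevConst Ω C) (w u : Wave Ω) :
    Integrable (fun x => (∑ j, ‖fn (w j) x‖ ^ 2) * ∑ i, ‖fn (u i) x‖ ^ 2)
      (volume.restrict (Ω : Set (Space d))) := by
  simp only [Finset.sum_mul_sum]
  exact integrable_finsetSum _ fun j _ => integrable_finsetSum _ fun i _ =>
    integrable_quartic hC (w j) (u i)

theorem integral_wave_quartic_le {C : NNReal} (hC : IsSobolevConst Ω C) (w u : Wave Ω) :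
    ∫ x in (Ω : Set (Space d)), (∑ j, ‖fn (w j) x‖ ^ 2) * ∑ i, ‖fn (u i) x‖ ^ 2 ≤
      4 * C ^ 3 * normH10 w ^ 2 * normH10 u * normL2 u := by
  simp only [Finset.sum_mul_sum]
  rw [integral_finsetSum _ fun j _ => integrable_finsetSum _ fun i _ =>
    integrable_quartic hC (w j) (u i)]
  have hle : ∀ i j : Fin 2, ∫ x in (Ω : Set (Space d)), ‖fn (w j) x‖ ^ 2 * ‖fn (u i) x‖ ^ 2 ≤
      C ^ 3 * normH10 w ^ 2 * normH10 u * normL2 u := by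
    intro i j
    refine (integral_quartic_le hC (w j) (u i)).trans ?_
    rw [← mul_assoc]
    have := nrm1_nonneg (w j)
    have := nrm1_nonneg (u i)
    have := nrm0_nonneg (u i)
    have := normH10_nonneg w
    have := normH10_nonneg u
    gcongr
    · exact nrm1_le_normH10 w j
    · exact nrm1_le_normH10 u i
    · exact nrm0_le_normL2 u i
  calc _ = ∑ j, ∑ i, ∫ x in (Ω : Set (Space d)), ‖fn (w j) x‖ ^ 2 * ‖fn (u i) x‖ ^ 2 :=
        Finset.sum_congr rfl fun j _ => integral_finsetSum _ fun i _ =>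
          integrable_quartic hC (w j) (u i)
    _ ≤ ∑ _j : Fin 2, ∑ _i : Fin 2, C ^ 3 * normH10 w ^ 2 * normH10 u * normL2 u :=
        Finset.sum_le_sum fun j _ => Finset.sum_le_sum fun i _ => hle i j
    _ = _ := by
        simp only [Fin.sum_univ_two]
        ring

section Estimates

variable [NeZero d] {C : NNReal} {α : ℝ} {P : Data d}

theorem hamiltonian_self_ge (hd : d = 2 ∨ d = 3) (hΩ : Bornology.IsBounded (Ω : Set (Space d)))
    (hα : 0 < α) (hC : IsSobolevConst Ω C) (hA : A1 Ω α P) (Ψ u : Wave Ω) :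
    C0 α * normH10 u ^ 2 - P.km * (4 * C ^ 3 * normH10 Ψ ^ 2 * normH10 u * normL2 u) ≤
      hamiltonian P Ψ u u := by
  have hq := mul_le_mul_of_nonneg_left (integral_wave_quartic_le hC Ψ u) P.km_nonneg
  have h : ∫ x in (Ω : Set (Space d)), (C0 α * (∑ i, ∑ j, ‖pd (u i) j x‖ ^ 2)
      - P.km * ((∑ j, ‖fn (Ψ j) x‖ ^ 2) * ∑ i, ‖fn (u i) x‖ ^ 2)) ≤ hamiltonian P Ψ u u := by
    rw [hamiltonian_self hΩ hC hA]
    refine integral_mono_ae (((integrable_grad u).const_mul _).sub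
      ((integrable_wave_quartic hC Ψ u).const_mul _)) (integrable_hamDensity hΩ hC hA Ψ u) ?_
    filter_upwards [quadDensity_ge hd hα hA u] with x hx
    linarith [neg_le_sum_rho_mul P Ψ u x]
  rw [integral_sub ((integrable_grad u).const_mul _)
    ((integrable_wave_quartic hC Ψ u).const_mul _), integral_const_mul, integral_const_mul,
    integral_grad] at h
  linarith

theorem energy_ge (hd : d = 2 ∨ d = 3) (hΩ : Bornology.IsBounded (Ω : Set (Space d)))
    (hα : 0 < α) (hC : IsSobolevConst Ω C) (hA : A1 Ω α P) (hA2 : A2 P) (Ψ : Wave Ω) :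
    C0 α * normH10 Ψ ^ 2 ≤ energy P Ψ := by
  rw [← integral_grad, ← integral_const_mul, energy]
  refine integral_mono_ae ((integrable_grad Ψ).const_mul _)
    (integrable_energyDensity hΩ hC hA Ψ) ?_
  filter_upwards [quadDensity_ge hd hα hA Ψ] with x hx
  rw [energyDensity_eq]
  linarith [hA2.sum_rho_nonneg Ψ x]

theorem hamiltonian_self_le_energy (hd : d = 2 ∨ d = 3)
    (hΩ : Bornology.IsBounded (Ω : Set (Space d)))
    (hα : 0 < α) (hC : IsSobolevConst Ω C) (hA : A1 Ω α P) (Ψ : Wave Ω) :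
    hamiltonian P Ψ Ψ Ψ ≤ 2 * energy P Ψ := by
  rw [hamiltonian_self hΩ hC hA, energy, ← integral_const_mul]
  refine integral_mono_ae (integrable_hamDensity hΩ hC hA Ψ Ψ)
    ((integrable_energyDensity hΩ hC hA Ψ).const_mul _) ?_
  filter_upwards [quadDensity_ge hd hα hA Ψ] with x hx
  have h0 : 0 ≤ C0 α * ∑ i, ∑ j, ‖pd (Ψ i) j x‖ ^ 2 :=
    mul_nonneg (C0_pos hα).le
      (Finset.sum_nonneg fun i _ => Finset.sum_nonneg fun j _ => sq_nonneg _)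
  rw [energyDensity_eq]
  linarith

theorem energy_sub_le (hΩ : Bornology.IsBounded (Ω : Set (Space d)))
    (hC : IsSobolevConst Ω C) (hA : A1 Ω α P) (hA2 : A2 P) (Φ Ψ : Wave Ω) :
    energy P Φ - energy P Ψ ≤ hamiltonian P Ψ Φ Φ - hamiltonian P Ψ Ψ Ψ
      + P.km * (4 * C ^ 3 * (normH10 Φ ^ 2 + normH10 Ψ ^ 2) * normH10 (Φ - Ψ)
          * normL2 (Φ - Ψ)) := by
  have hE := fun Ψ => integrable_energyDensity hΩ hC hA Ψ
  have hH := fun u => integrable_hamDensity hΩ hC hA Ψ u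
  have hq := fun w => integrable_wave_quartic hC w (Φ - Ψ)
  have h : energy P Φ - energy P Ψ ≤ hamiltonian P Ψ Φ Φ - hamiltonian P Ψ Ψ Ψ
      + P.km * ((∫ x in (Ω : Set (Space d)),
          (∑ j, ‖fn (Φ j) x‖ ^ 2) * ∑ i, ‖fn ((Φ - Ψ) i) x‖ ^ 2)
        + ∫ x in (Ω : Set (Space d)),
          (∑ j, ‖fn (Ψ j) x‖ ^ 2) * ∑ i, ‖fn ((Φ - Ψ) i) x‖ ^ 2) := by
    rw [hamiltonian_self hΩ hC hA, hamiltonian_self hΩ hC hA, energy, energy,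
      ← integral_sub (hE Φ) (hE Ψ), ← integral_sub (hH Φ) (hH Ψ),
      ← integral_add (hq Φ) (hq Ψ), ← integral_const_mul]
    have hH' := (hH Φ).sub (hH Ψ)
    have hq' := ((hq Φ).add (hq Ψ)).const_mul P.km
    refine le_of_le_of_eq ?_ (integral_add hH' hq')
    refine integral_mono_ae ((hE Φ).sub (hE Ψ)) (hH'.add hq') ?_
    filter_upwards [fn_sub (Φ 0) (Ψ 0), fn_sub (Φ 1) (Ψ 1)] with x h0 h1
    have hs : ∑ i, ‖fn (Φ i) x - fn (Ψ i) x‖ ^ 2 = ∑ i, ‖fn ((Φ - Ψ) i) x‖ ^ 2 := by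
      simp only [Fin.sum_univ_two, PiLp.sub_apply, h0, h1, Pi.sub_apply]
    have h2 := sum_K_mul_sub_le P (fun i => fn (Φ i) x) (fun i => fn (Ψ i) x)
    rw [hs, add_mul] at h2
    have h3 := energyDensity_sub_eq hA2 Φ Ψ x
    beta_reduce at h2 ⊢
    linarith
  refine h.trans ?_
  have h3 := mul_le_mul_of_nonneg_left (add_le_add (integral_wave_quartic_le hC Φ (Φ - Ψ))
    (integral_wave_quartic_le hC Ψ (Φ - Ψ))) P.km_nonneg
  linarith

end Estimates

/-! ### Abstract ingredients of the time stepping -/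

/-- The Lax-Milgram theorem, for functionals instead of elements of the space. -/
theorem existsUnique_of_coercive {V : Type*} [NormedAddCommGroup V] [InnerProductSpace ℝ V]
    [CompleteSpace V] {B : V →L[ℝ] V →L[ℝ] ℝ} {c : ℝ} (hc : 0 < c)
    (hle : ∀ u, c * ‖u‖ ^ 2 ≤ B u u) (w : V →L[ℝ] ℝ) :
    ∃! u, ∀ v, B u v = w v := by
  have coercive : IsCoercive B := ⟨c, hc, fun u => by
    rw [mul_assoc, ← sq]
    exact hle u⟩
  set f := (InnerProductSpace.toDual ℝ V).symm w with hf
  have hfw : ∀ v, inner ℝ f v = w v := fun v => InnerProductSpace.toDual_symm_apply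
  refine ⟨coercive.continuousLinearEquivOfBilin.symm f, fun v => ?_, fun u hu => ?_⟩
  · rw [← coercive.continuousLinearEquivOfBilin_apply,
      ContinuousLinearEquiv.apply_symm_apply, hfw]
  · rw [ContinuousLinearEquiv.eq_symm_apply]
    refine (coercive.unique_continuousLinearEquivOfBilin fun v => ?_).symm
    rw [hfw, hu]

/-- If `(J + τ H) Φ = r J Ψ` with `r ≥ 0` and `J Ψ Ψ = J Φ Φ = 1`, then
`H Φ Φ - H Ψ Ψ = -(1 + r)/τ · J (Φ - Ψ) (Φ - Ψ) - H (Φ - Ψ) (Φ - Ψ)`. The normalization factor `r`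
enters with a favourable sign, so no bound on it is needed. -/
theorem quadratic_sub_le_of_implicit_step {V : Type*} [NormedAddCommGroup V]
    [InnerProductSpace ℝ V] {J H : V →L[ℝ] V →L[ℝ] ℝ}
    (hJ : ∀ u v, J u v = J v u) (hH : ∀ u v, H u v = H v u)
    (hpos : ∀ u, 0 ≤ J u u) {τ r : ℝ} (hτ : 0 < τ) (hr : 0 ≤ r) {Ψ Φ : V} (hΨ : J Ψ Ψ = 1)
    (hΦ : J Φ Φ = 1) (h : ∀ v, J Φ v + τ * H Φ v = r * J Ψ v) :
    H Φ Φ - H Ψ Ψ ≤ -(1 / τ) * J (Φ - Ψ) (Φ - Ψ) - H (Φ - Ψ) (Φ - Ψ) := by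
  have h1 := h Φ
  have h2 := h Ψ
  rw [hΦ] at h1
  rw [hΨ, hJ Φ, hH Φ] at h2
  have hJδ : J (Φ - Ψ) (Φ - Ψ) = 2 - 2 * J Ψ Φ := by
    simp only [map_sub, sub_apply, hΨ, hΦ, hJ Φ Ψ]
    ring
  have hHδ : H (Φ - Ψ) (Φ - Ψ) = H Φ Φ - 2 * H Ψ Φ + H Ψ Ψ := by
    simp only [map_sub, sub_apply, hH Φ Ψ]
    ring
  have e1 : H Φ Φ = (r * J Ψ Φ - 1) / τ := by
    rw [eq_div_iff hτ.ne']
    linarith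
  have e2 : H Ψ Φ = (r - J Ψ Φ) / τ := by
    rw [eq_div_iff hτ.ne']
    linarith
  have key : H Φ Φ - H Ψ Ψ = -(1 / τ) * J (Φ - Ψ) (Φ - Ψ) - H (Φ - Ψ) (Φ - Ψ)
      - r / τ * J (Φ - Ψ) (Φ - Ψ) := by
    rw [hHδ, hJδ, e1, e2]
    field_simp
    ring
  linarith [mul_nonneg (div_nonneg hr hτ.le) (hpos (Φ - Ψ))]

/-- A relation that is a function on an invariant set generates exactly one sequence from each
point of the set. -/
theorem existsUnique_seq {X : Type*} {S : Set X} {r : X → X → Prop}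
    (hstep : ∀ x ∈ S, ∃! y, r x y) (hnext : ∀ x ∈ S, ∀ y, r x y → y ∈ S) {x₀ : X} (h₀ : x₀ ∈ S) :
    ∃! f : ℕ → X, f 0 = x₀ ∧ ∀ n, r (f n) (f (n + 1)) := by
  choose g hg huniq using hstep
  let G : S → S := fun x => ⟨g x.1 x.2, hnext _ x.2 _ (hg x.1 x.2)⟩
  let F : ℕ → S := fun n => G^[n] ⟨x₀, h₀⟩
  have hF : ∀ n, r (F n).1 (F (n + 1)).1 := fun n => by
    rw [show F (n + 1) = G (F n) from Function.iterate_succ_apply' G n _]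
    exact hg (F n).1 (F n).2
  refine ⟨fun n => F n, ⟨rfl, hF⟩, fun f hf => funext fun n => ?_⟩
  induction n with
  | zero => exact hf.1
  | succ n ih =>
    have h := hf.2 n
    rw [ih] at h
    exact (huniq _ (F n).2 _ h).trans (huniq _ (F n).2 _ (hF n)).symm

/-- Young's inequality, absorbing one factor `a` into `c a²`. -/
theorem mul_mul_le_half_add {c : ℝ} (hc : 0 < c) (N a b : ℝ) :
    N * a * b ≤ c / 2 * a ^ 2 + N ^ 2 / (2 * c) * b ^ 2 := by
  have h : c / 2 * a ^ 2 + N ^ 2 / (2 * c) * b ^ 2 - N * a * b = c / 2 * (a - N * b / c) ^ 2 := by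
    field_simp
    ring
  have : 0 ≤ c / 2 * (a - N * b / c) ^ 2 := by positivity
  linarith

/-! ### Solvability of the implicit equation -/

theorem waveInnerL2_eq_zero {u v : Wave Ω} (hv : normL2 v = 0) : waveInnerL2 u v = 0 := by
  refine Finset.sum_eq_zero fun i _ => ?_
  have h0 : nrm0 (v i) = 0 := le_antisymm (hv ▸ nrm0_le_normL2 v i) (nrm0_nonneg _)
  have h := abs_innerL2_le (u i) (v i)
  rw [h0, mul_zero] at h
  exact abs_nonpos_iff.mp h

theorem waveInnerL2_self_eq (u : Wave Ω) : waveInnerL2 u u = normL2 u ^ 2 := by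
  rw [waveInnerL2_self, normL2_sq]

/-! Shortcut instances, without which the unifier unfolds the Hilbert space structures of the
components whenever an abstract result is applied to `[H¹₀(Ω)]²`. -/

instance : NormedAddCommGroup (Wave Ω) := PiLp.normedAddCommGroup 2 _

instance : InnerProductSpace ℝ (Wave Ω) := PiLp.innerProductSpace _

instance : NormedSpace ℝ (Wave Ω) := InnerProductSpace.toNormedSpace

section Step

variable [NeZero d] {C : NNReal} {α τ R : ℝ} {P : Data d}

/-- The Hamiltonian is coercive up to a multiple of the squared `L²` norm. -/
theorem hamiltonian_self_ge_of_bound (hd : d = 2 ∨ d = 3)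
    (hΩ : Bornology.IsBounded (Ω : Set (Space d)))
    (hα : 0 < α) (hC : IsSobolevConst Ω C) (hA : A1 Ω α P) {Ψ : Wave Ω}
    (hR : normH10 Ψ ^ 2 ≤ R) (u : Wave Ω) :
    C0 α * normH10 u ^ 2 - 4 * C ^ 3 * P.km * R * normH10 u * normL2 u ≤
      hamiltonian P Ψ u u := by
  refine le_trans ?_ (hamiltonian_self_ge hd hΩ hα hC hA Ψ u)
  have h1 : 4 * C ^ 3 * P.km * normH10 Ψ ^ 2 * normH10 u * normL2 u ≤
      4 * C ^ 3 * P.km * R * normH10 u * normL2 u := by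
    have := P.km_nonneg
    have := normH10_nonneg u
    have := normL2_nonneg u
    gcongr
  linarith

/-- With the `L²` part of the implicit form added, the Hamiltonian is coercive for small `τ`. -/
theorem exists_implicitForm_coercive (hd : d = 2 ∨ d = 3)
    (hΩ : Bornology.IsBounded (Ω : Set (Space d)))
    (hα : 0 < α) (hC : IsSobolevConst Ω C) (hA : A1 Ω α P) {Ψ : Wave Ω}
    (hR : normH10 Ψ ^ 2 ≤ R) (hτ : 0 < τ)
    (hτL : τ * ((4 * C ^ 3 * P.km * R) ^ 2 / (2 * C0 α)) < 1) :
    ∃ c, 0 < c ∧ ∀ u, c * ‖u‖ ^ 2 ≤ implicitForm P τ Ψ u u := by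
  set L := (4 * C ^ 3 * P.km * R) ^ 2 / (2 * C0 α) with hL
  have hc := C0_pos hα
  refine ⟨min (1 - τ * L) (τ * (C0 α / 2)), lt_min (by linarith) (by positivity), fun u => ?_⟩
  have h1 := hamiltonian_self_ge_of_bound hd hΩ hα hC hA hR u
  have h2 := mul_mul_le_half_add hc (4 * C ^ 3 * P.km * R) (normH10 u) (normL2 u)
  have h3 : τ * (C0 α / 2 * normH10 u ^ 2 - L * normL2 u ^ 2) ≤ τ * hamiltonian P Ψ u u :=
    mul_le_mul_of_nonneg_left (by rw [hL]; linarith) hτ.le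
  have h4 := mul_le_mul_of_nonneg_right (min_le_left (1 - τ * L) (τ * (C0 α / 2)))
    (sq_nonneg (normL2 u))
  have h5 := mul_le_mul_of_nonneg_right (min_le_right (1 - τ * L) (τ * (C0 α / 2)))
    (sq_nonneg (normH10 u))
  rw [implicitForm, wave_norm_sq, waveInnerL2_self, ← normL2_sq]
  linarith

theorem exists_form_implicitForm (hΩ : Bornology.IsBounded (Ω : Set (Space d)))
    (hC : IsSobolevConst Ω C) (hA : A1 Ω α P) (τ : ℝ) (Ψ : Wave Ω) :
    ∃ B : Wave Ω →L[ℝ] Wave Ω →L[ℝ] ℝ, ∀ u v, B u v = implicitForm P τ Ψ u v := by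
  obtain ⟨J, hJ⟩ := exists_form_waveInnerL2 Ω
  obtain ⟨H, hH⟩ := exists_form_hamiltonian hΩ hC hA Ψ
  exact ⟨J + τ • H, fun u v => by simp [implicitForm, hJ, hH]⟩

/-- The Lax-Milgram theorem for the implicit form. -/
theorem implicitSolvable_of_coercive (hΩ : Bornology.IsBounded (Ω : Set (Space d)))
    (hC : IsSobolevConst Ω C) (hA : A1 Ω α P) {Ψ : Wave Ω}
    (hco : ∃ c, 0 < c ∧ ∀ u, c * ‖u‖ ^ 2 ≤ implicitForm P τ Ψ u u) :
    ImplicitSolvable P τ Ψ := by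
  obtain ⟨B, hB⟩ := exists_form_implicitForm hΩ hC hA τ Ψ
  obtain ⟨c, hc, hle⟩ := hco
  intro w
  obtain ⟨u, hu, huniq⟩ := existsUnique_of_coercive (V := Wave Ω) (B := B) hc
    (fun u => (hle u).trans_eq (hB u u).symm) w
  exact ⟨u, fun v => (hB u v).symm.trans (hu v), fun u' hu' =>
    huniq u' fun v => (hB u' v).trans (hu' v)⟩

theorem existsUnique_step (hΩ : Bornology.IsBounded (Ω : Set (Space d)))
    (hC : IsSobolevConst Ω C) (hA : A1 Ω α P) {Ψ : Wave Ω} (hΨ : normL2 Ψ = 1)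
    (hco : ∃ c, 0 < c ∧ ∀ u, c * ‖u‖ ^ 2 ≤ implicitForm P τ Ψ u u) :
    ∃! Φ, IsGFSIStep P τ Ψ Φ := by
  obtain ⟨J, hJ⟩ := exists_form_waveInnerL2 Ω
  obtain ⟨B, hB⟩ := exists_form_implicitForm hΩ hC hA τ Ψ
  obtain ⟨u, hu, huniq⟩ := implicitSolvable_of_coercive hΩ hC hA hco (J Ψ)
  simp only [hJ] at hu huniq
  have hne : normL2 u ≠ 0 := by
    intro h0
    obtain ⟨c, hc, hle⟩ := hco
    have h1 := hle u
    rw [hu, waveInnerL2_eq_zero h0] at h1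
    have h2 : u = 0 := by
      have h3 : ‖u‖ ^ 2 = 0 := le_antisymm (nonpos_of_mul_nonpos_right h1 hc) (sq_nonneg _)
      simpa using h3
    have h4 := hu Ψ
    rw [h2, ← hB, map_zero, waveInnerL2_self_eq, hΨ] at h4
    simp at h4
  refine ⟨_, ⟨u, hu, hne, rfl⟩, ?_⟩
  rintro Φ ⟨u', hu', -, rfl⟩
  rw [huniq u' hu']

theorem IsGFSIStep.normL2_eq_one {Ψ Φ : Wave Ω} (h : IsGFSIStep P τ Ψ Φ) : normL2 Φ = 1 := by
  obtain ⟨u, -, hu, rfl⟩ := h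
  rw [normL2_smul, abs_inv, abs_of_nonneg (normL2_nonneg u), inv_mul_cancel₀ hu]

/-! ### Energy dissipation in one step -/

theorem hamiltonian_sub_le (hd : d = 2 ∨ d = 3) (hΩ : Bornology.IsBounded (Ω : Set (Space d)))
    (hC : IsSobolevConst Ω C) (hA : A1 Ω α P) {Ψ Φ : Wave Ω} (hτ : 0 < τ) (hΨ : normL2 Ψ = 1)
    (h : IsGFSIStep P τ Ψ Φ) :
    hamiltonian P Ψ Φ Φ - hamiltonian P Ψ Ψ Ψ ≤
      -(1 / τ) * normL2 (Φ - Ψ) ^ 2 - hamiltonian P Ψ (Φ - Ψ) (Φ - Ψ) := by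
  have hΦ := h.normL2_eq_one
  obtain ⟨u, hu, hne, rfl⟩ := h
  obtain ⟨J, hJ⟩ := exists_form_waveInnerL2 Ω
  obtain ⟨H, hH⟩ := exists_form_hamiltonian hΩ hC hA Ψ
  have hs : 0 ≤ (normL2 u)⁻¹ := inv_nonneg.mpr (normL2_nonneg u)
  have hJsq : ∀ v, J v v = normL2 v ^ 2 := fun v => by rw [hJ, waveInnerL2_self_eq]
  have key := quadratic_sub_le_of_implicit_step (V := Wave Ω) (J := J) (H := H)
    (Ψ := Ψ) (Φ := (normL2 u)⁻¹ • u) (fun v w => ?_) (fun v w => ?_) (fun v => ?_) hτ hs ?_ ?_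
    fun v => ?_
  · rwa [hJsq, hH, hH, hH] at key
  · rw [hJ, hJ, waveInnerL2_comm]
  · rw [hH, hH, hamiltonian_comm hd hΩ hC hA]
  · rw [hJsq]
    exact sq_nonneg _
  · rw [hJsq, hΨ, one_pow]
  · rw [hJsq, hΦ, one_pow]
  · have h := hu v
    rw [implicitForm, ← hJ, ← hJ, ← hH] at h
    rw [map_smul, map_smul, ← h]
    change (normL2 u)⁻¹ * J u v + τ * ((normL2 u)⁻¹ * H u v) = _
    ring

/-- A bound on `‖∇Ψ‖²` for wave functions of energy at most `e`. -/
def gradBound (α e : ℝ) : ℝ := |e| / C0 α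

/-- The amount by which the Hamiltonian fails to be nonnegative, relative to the squared `L²`
norm, at wave functions of energy at most `e`. -/
def shift (α c e k : ℝ) : ℝ := (4 * c ^ 3 * k * gradBound α e) ^ 2 / (2 * C0 α)

/-- A bound on `‖∇Φ‖²` after one step of the scheme from a wave function of energy at most `e`. -/
def nextGradBound (α c e k : ℝ) : ℝ := 2 * (2 * |e| + shift α c e k) / C0 α

/-- The quotient of the error terms and `‖∇(Φ - Ψ)‖ ‖Φ - Ψ‖` in one step of the scheme. -/
def errorConst (α c e k : ℝ) : ℝ :=
  4 * c ^ 3 * k * (nextGradBound α c e k + 2 * gradBound α e)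

/-- The threshold for the time step, in terms of the Sobolev constant `c`, the energy `e` and the
interaction strength `k`. -/
def stepBound (α c e k : ℝ) : ℝ :=
  1 / (1 + shift α c e k + errorConst α c e k ^ 2 / (2 * C0 α))

theorem shift_nonneg (hα : 0 < α) (c e k : ℝ) : 0 ≤ shift α c e k :=
  div_nonneg (sq_nonneg _) (mul_pos two_pos (C0_pos hα)).le

theorem errorConst_sq_nonneg (hα : 0 < α) (c e k : ℝ) :
    0 ≤ errorConst α c e k ^ 2 / (2 * C0 α) :=
  div_nonneg (sq_nonneg _) (mul_pos two_pos (C0_pos hα)).le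

theorem stepBound_pos (hα : 0 < α) (c e k : ℝ) : 0 < stepBound α c e k := by
  have := shift_nonneg hα c e k
  have := errorConst_sq_nonneg hα c e k
  unfold stepBound
  positivity

theorem lt_one_div_of_lt_stepBound (hα : 0 < α) {c e k : ℝ} (hτ : 0 < τ)
    (h : τ < stepBound α c e k) :
    1 + shift α c e k + errorConst α c e k ^ 2 / (2 * C0 α) < 1 / τ := by
  have := shift_nonneg hα c e k
  have := errorConst_sq_nonneg hα c e k
  rw [stepBound] at h
  rwa [lt_one_div hτ (by positivity)] at h

theorem normH10_sq_le_gradBound (hd : d = 2 ∨ d = 3) (hΩ : Bornology.IsBounded (Ω : Set (Space d)))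
    (hα : 0 < α) (hC : IsSobolevConst Ω C) (hA : A1 Ω α P) (hA2 : A2 P) {Ψ : Wave Ω} {e : ℝ}
    (he : energy P Ψ ≤ e) : normH10 Ψ ^ 2 ≤ gradBound α e := by
  rw [gradBound, le_div_iff₀ (C0_pos hα), mul_comm]
  exact (energy_ge hd hΩ hα hC hA hA2 Ψ).trans (he.trans (le_abs_self e))

theorem coercive_of_energy_le (hd : d = 2 ∨ d = 3) (hΩ : Bornology.IsBounded (Ω : Set (Space d)))
    (hα : 0 < α) (hC : IsSobolevConst Ω C) (hA : A1 Ω α P) (hA2 : A2 P) {Ψ : Wave Ω} {e : ℝ}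
    (he : energy P Ψ ≤ e) (hτ : 0 < τ) (hτ' : τ < stepBound α C e P.km) :
    ∃ c, 0 < c ∧ ∀ u, c * ‖u‖ ^ 2 ≤ implicitForm P τ Ψ u u := by
  refine exists_implicitForm_coercive hd hΩ hα hC hA
    (normH10_sq_le_gradBound hd hΩ hα hC hA hA2 he) hτ ?_
  have h1 := lt_one_div_of_lt_stepBound hα hτ hτ'
  have h2 := errorConst_sq_nonneg hα C e P.km
  have h3 : shift α C e P.km < 1 / τ := by linarith
  rw [lt_div_iff₀ hτ, mul_comm] at h3
  exact h3

/-- Energy dissipation in one step. The gradient of the new iterate is bounded first, through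
`⟨HΦ, Φ⟩ ≤ ⟨HΨ, Ψ⟩ ≤ 2 E(Ψ)`; then the quartic remainder of the energy is absorbed by
`‖∇(Φ - Ψ)‖²` and `‖Φ - Ψ‖² / τ`. -/
theorem energy_step_le (hd : d = 2 ∨ d = 3) (hΩ : Bornology.IsBounded (Ω : Set (Space d)))
    (hα : 0 < α) (hC : IsSobolevConst Ω C) (hA : A1 Ω α P) (hA2 : A2 P) {Ψ Φ : Wave Ω} {e : ℝ}
    (he : energy P Ψ ≤ e) (hτ : 0 < τ) (hτ' : τ < stepBound α C e P.km) (hΨ : normL2 Ψ = 1)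
    (h : IsGFSIStep P τ Ψ Φ) :
    energy P Φ - energy P Ψ ≤ -(C0 α / 2) * normH10 (Φ - Ψ) ^ 2 := by
  have hc := C0_pos hα
  have hk := P.km_nonneg
  have hτinv := lt_one_div_of_lt_stepBound hα hτ hτ'
  have hM0 := errorConst_sq_nonneg hα C e P.km
  have hL0 := shift_nonneg hα C e P.km
  have hg := normH10_sq_le_gradBound hd hΩ hα hC hA hA2 he
  have hstep := hamiltonian_sub_le hd hΩ hC hA hτ hΨ h
  have hcoer := hamiltonian_self_ge_of_bound hd hΩ hα hC hA hg
  have hcoer' : ∀ u : Wave Ω, C0 α / 2 * normH10 u ^ 2 - shift α C e P.km * normL2 u ^ 2 ≤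
      hamiltonian P Ψ u u := by
    intro u
    have h1 := hcoer u
    have h2 := mul_mul_le_half_add hc (4 * C ^ 3 * P.km * gradBound α e) (normH10 u) (normL2 u)
    rw [shift]
    linarith
  have hgΦ : normH10 Φ ^ 2 ≤ nextGradBound α C e P.km := by
    have h1 := hcoer' Φ
    have h2 := hcoer' (Φ - Ψ)
    have h3 := hamiltonian_self_le_energy hd hΩ hα hC hA Ψ
    have h4 := mul_le_mul_of_nonneg_right
      (by linarith : shift α C e P.km ≤ 1 / τ) (sq_nonneg (normL2 (Φ - Ψ)))
    have h5 : 0 ≤ C0 α / 2 * normH10 (Φ - Ψ) ^ 2 := by positivity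
    rw [h.normL2_eq_one] at h1
    rw [nextGradBound, le_div_iff₀ hc]
    linarith [le_abs_self e]
  have hE := energy_sub_le hΩ hC hA hA2 Φ Ψ
  have h1 := hcoer (Φ - Ψ)
  set a := normH10 (Φ - Ψ)
  set b := normL2 (Φ - Ψ)
  have ha : 0 ≤ a := normH10_nonneg _
  have hb : 0 ≤ b := normL2_nonneg _
  have h2 : P.km * (4 * C ^ 3 * (normH10 Φ ^ 2 + normH10 Ψ ^ 2) * a * b) ≤
      P.km * (4 * C ^ 3 * (nextGradBound α C e P.km + gradBound α e) * a * b) := by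
    gcongr
  have h3 : errorConst α C e P.km * a * b =
      4 * C ^ 3 * P.km * gradBound α e * a * b
        + P.km * (4 * C ^ 3 * (nextGradBound α C e P.km + gradBound α e) * a * b) := by
    rw [errorConst]
    ring
  have h4 := mul_mul_le_half_add hc (errorConst α C e P.km) a b
  have h5 := mul_le_mul_of_nonneg_right
    (by linarith : errorConst α C e P.km ^ 2 / (2 * C0 α) ≤ 1 / τ) (sq_nonneg b)
  linarith

end Step

end GrossPitaevskii

end

open GrossPitaevskii in
theorem theorem3p1 (d : ℕ) [NeZero d] (hd : d = 2 ∨ d = 3)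
    (Ω : TopologicalSpace.Opens (Space d))
    (hΩ : Bornology.IsBounded (Ω : Set (Space d))) (α : ℝ) (hα : 0 < α) :
    ∃ τ₀ : ℝ → ℝ → ℝ, (∀ e k, 0 < τ₀ e k) ∧
      ∀ P : Data d, A1 Ω α P → A2 P → ∀ Ψ0 ∈ admissible Ω P,
        ∀ τ : ℝ, 0 < τ → τ < τ₀ (energy P Ψ0) P.km →
          (∃! Ψ : ℕ → Wave Ω, IsGFSISequence P τ Ψ0 Ψ) ∧
          ∀ Ψ : ℕ → Wave Ω, IsGFSISequence P τ Ψ0 Ψ → ∀ n,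
            ImplicitSolvable P τ (Ψ n) ∧ Ψ n ∈ admissible Ω P ∧
            energy P (Ψ (n + 1)) - energy P (Ψ n)
              ≤ -(C0 α / 2) * normH10 (Ψ (n + 1) - Ψ n) ^ 2 := by
  obtain ⟨C, hC⟩ := exists_eLpNorm_six_le hd hΩ
  refine ⟨stepBound α C, stepBound_pos hα C, fun P hA hA2 Ψ0 hΨ0 τ hτ hτ' => ?_⟩
  -- The states reached by the scheme, along which the threshold for `τ` stays valid.
  set S : Set (Wave Ω) := {Ψ | normL2 Ψ = 1 ∧ energy P Ψ ≤ energy P Ψ0} with hS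
  have hdiss : ∀ Ψ ∈ S, ∀ Φ, IsGFSIStep P τ Ψ Φ →
      energy P Φ - energy P Ψ ≤ -(C0 α / 2) * normH10 (Φ - Ψ) ^ 2 := fun Ψ hΨ Φ h =>
    energy_step_le hd hΩ hα hC hA hA2 hΨ.2 hτ hτ' hΨ.1 h
  have hnext : ∀ Ψ ∈ S, ∀ Φ, IsGFSIStep P τ Ψ Φ → Φ ∈ S := fun Ψ hΨ Φ h => by
    refine ⟨h.normL2_eq_one, ?_⟩
    have h1 := hdiss Ψ hΨ Φ h
    have h2 : 0 ≤ C0 α / 2 * normH10 (Φ - Ψ) ^ 2 :=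
      mul_nonneg (half_pos (C0_pos hα)).le (sq_nonneg _)
    linarith [hΨ.2]
  have hco := fun (Ψ : Wave Ω) (hΨ : Ψ ∈ S) =>
    coercive_of_energy_le hd hΩ hα hC hA hA2 hΨ.2 hτ hτ'
  have hstep : ∀ Ψ ∈ S, ∃! Φ, IsGFSIStep P τ Ψ Φ := fun Ψ hΨ =>
    existsUnique_step hΩ hC hA hΨ.1 (hco Ψ hΨ)
  have h0 : Ψ0 ∈ S := ⟨hΨ0.1, le_rfl⟩
  have hmem : ∀ Ψ : ℕ → Wave Ω, IsGFSISequence P τ Ψ0 Ψ → ∀ n, Ψ n ∈ S := by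
    intro Ψ hΨ n
    induction n with
    | zero => rw [hΨ.1]; exact h0
    | succ n ih => exact hnext _ ih _ (hΨ.2 n)
  exact ⟨existsUnique_seq hstep hnext h0, fun Ψ hΨ n =>
    ⟨implicitSolvable_of_coercive hΩ hC hA (hco _ (hmem Ψ hΨ n)),
      ⟨(hmem Ψ hΨ n).1, integrable_energyDensity hΩ hC hA _⟩,
      hdiss _ (hmem Ψ hΨ n) _ (hΨ.2 n)⟩⟩
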